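/- Let $a,m,k,\tau,b>0$ and $0<L_1<L_2<L_3$. Write $I=(L_1,L_2)$ and $J=(0,L_1)\cup(L_2,L_3)$. Let $\mathcal H$ be the complex Hilbert space of all $U=[u^1,v^1,\theta,q,u^2,v^2]'\in H^1(I)\times H^1(J)\times L^2(I)\times L^2(I)\times L^2(I)\times L^2(J)$ with $v^1(0)=v^1(L_3)=0$ and $u^1(L_i)=v^1(L_i)$ for $i=1,2$, equipped with the inner product \[ \langle U,\tilde U\rangle_{\mathcal H}=\int_I\left(a\,u^1_x\overline{\tilde u^1_x}+u^2\overline{\tilde u^2}+\theta\overline{\tilde\theta}+\tau q\overline{\tilde q}\right)dx+\int_J\left(b\,v^1_x\overline{\tilde v^1_x}+v^2\overline{\tilde v^2}\right)dx . \] Let $\mathcal A\colon\mathcal H\supseteq D(\mathcal A)\to\mathcal H$ be the operator \[ \mathcal AU=\left[u^2,\;v^2,\;-(kq+mu^2)_x,\;-\tfrac{k}{\tau}\theta_x-\tfrac1\tau q,\;(au^1_x-m\theta)_x,\;bv^1_{xx}\right]' \] whose domain $D(\mathcal A)$ consists of all $U\in\mathcal H$ with $u^1\in H^2(I)$, $v^1\in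 H^2(J)$, $\theta,q,u^2\in H^1(I)$, $v^2\in H^1(J)$, $v^2(0)=v^2(L_3)=0$ and, for $i=1,2$, $u^2(L_i)=v^2(L_i)$, $q(L_i)=0$, $au^1_x(L_i)-m\theta(L_i)=bv^1_x(L_i)$. Then $0\in\sigma(\mathcal A)$; more precisely, $0$ is an eigenvalue of $\mathcal A$, its kernel is one-dimensional, and \[ \ker(\mathcal A)=\operatorname{span}_{\mathcal H}\left\{[\zeta^1,\zeta^2,\zeta^3,0,0,0]'\right\}, \] where \[ \zeta^1(x)=\frac{L_2-L_1-L_3}{L_1L_3}x+1,\qquad \zeta^2(x)=\begin{cases}\frac{L_2-L_1}{L_1L_3}x,&x\in[0,L_1],\\[2pt]\frac{L_2-L_1}{L_1L_3}x-\frac{L_2-L_1}{L_1},&x\in[L_2,L_3],\end{cases}\qquad \zeta^3(x)=\frac{a(L_2-L_1-L_3)-b(L_2-L_1)}{mL_1L_3}. \] The stationary (that is, time-independent classical) solutions of $\frac{d}{dt}U(t)=\mathcal AU(t)$, $t\ge0$, are exactly the elements of this span. Moreover $i\mathbb R\setminus\{0\}\subseteq\rho(\mathcal A)$, hence $i\mathbb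 R\cap\sigma(\mathcal A)=\{0\}$. -/

import Mathlib

open MeasureTheory Set TopologicalSpace
open scoped ContDiff

noncomputable section

namespace ThermoelasticBar

/-- The complex Hilbert space `L²(Ω)` of an open set `Ω ⊆ ℝ`. -/
abbrev L2 (Ω : Opens ℝ) : Type := Lp ℂ 2 (volume.restrict (Ω : Set ℝ))

/-- Real test functions of `C₀^∞(Ω)`. -/
structure IsTestFunction (Ω : Opens ℝ) (φ : ℝ → ℝ) : Prop where
  contDiff : ContDiff ℝ ∞ φ
  hasCompactSupport : HasCompactSupport φ
  tsupport_subset : tsupport φ ⊆ Ω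

/-- `g` is the weak derivative of `f` on `Ω`:
`∫_Ω φ' f = - ∫_Ω φ g` for all test functions `φ`. -/
def HasWeakDeriv {Ω : Opens ℝ} (f g : L2 Ω) : Prop :=
  ∀ φ : ℝ → ℝ, IsTestFunction Ω φ →
    ∫ x in (Ω : Set ℝ), deriv φ x • f x = - ∫ x in (Ω : Set ℝ), φ x • g x

section WeakDerivative

variable {Ω : Opens ℝ}

theorem IsTestFunction.deriv {φ : ℝ → ℝ} (hφ : IsTestFunction Ω φ) :
    IsTestFunction Ω (deriv φ) where
  contDiff := (contDiff_infty_iff_deriv.1 hφ.contDiff).2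
  hasCompactSupport := hφ.hasCompactSupport.deriv
  tsupport_subset := (closure_mono (support_deriv_subset (f := φ))).trans
    ((closure_minimal subset_rfl (isClosed_tsupport φ)).trans hφ.tsupport_subset)

theorem IsTestFunction.integrable_smul {φ : ℝ → ℝ} (hφ : IsTestFunction Ω φ) (f : L2 Ω) :
    Integrable (fun x => φ x • f x) (volume.restrict (Ω : Set ℝ)) := by
  exact ((Lp.memLp f).locallyIntegrable one_le_two).integrable_smul_left_of_hasCompactSupport
    hφ.contDiff.continuous hφ.hasCompactSupport

theorem HasWeakDeriv.add {f g f' g' : L2 Ω} (h : HasWeakDeriv f f') (k : HasWeakDeriv g g') :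
    HasWeakDeriv (f + g) (f' + g') := by
  intro φ hφ
  have e1 : ∫ x in (Ω : Set ℝ), _root_.deriv φ x • (f + g : L2 Ω) x
      = ∫ x in (Ω : Set ℝ), (_root_.deriv φ x • f x + _root_.deriv φ x • g x) := by
    refine integral_congr_ae ?_
    filter_upwards [Lp.coeFn_add f g] with x hx
    rw [hx, Pi.add_apply, smul_add]
  have e2 : ∫ x in (Ω : Set ℝ), φ x • (f' + g' : L2 Ω) x
      = ∫ x in (Ω : Set ℝ), (φ x • f' x + φ x • g' x) := by
    refine integral_congr_ae ?_
    filter_upwards [Lp.coeFn_add f' g'] with x hx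
    rw [hx, Pi.add_apply, smul_add]
  rw [e1, e2, integral_add (hφ.deriv.integrable_smul f) (hφ.deriv.integrable_smul g),
    integral_add (hφ.integrable_smul f') (hφ.integrable_smul g'), h φ hφ, k φ hφ]
  ring

theorem HasWeakDeriv.smul {f f' : L2 Ω} (c : ℂ) (h : HasWeakDeriv f f') :
    HasWeakDeriv (c • f) (c • f') := by
  intro φ hφ
  have e (ψ : ℝ → ℝ) (u : L2 Ω) : ∫ x in (Ω : Set ℝ), ψ x • (c • u : L2 Ω) x
      = c * ∫ x in (Ω : Set ℝ), ψ x • u x := by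
    rw [← integral_const_mul]
    refine integral_congr_ae ?_
    filter_upwards [Lp.coeFn_smul c u] with x hx
    rw [hx, Pi.smul_apply, smul_comm, smul_eq_mul]
  rw [e, e, h φ hφ, mul_neg]

theorem HasWeakDeriv.zero : HasWeakDeriv (0 : L2 Ω) 0 := by
  intro φ _
  have e (ψ : ℝ → ℝ) : ∫ x in (Ω : Set ℝ), ψ x • (0 : L2 Ω) x = 0 := by
    rw [integral_eq_zero_of_ae]
    filter_upwards [Lp.coeFn_zero ℂ 2 (volume.restrict (Ω : Set ℝ))] with x hx
    rw [hx]
    simp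
  rw [e, e, neg_zero]

/-- A locally integrable function which annihilates all test functions vanishes. -/
theorem ae_eq_zero_of_test {h : ℝ → ℂ}
    (hh : LocallyIntegrable h (volume.restrict (Ω : Set ℝ)))
    (h0 : ∀ φ : ℝ → ℝ, IsTestFunction Ω φ → ∫ x in (Ω : Set ℝ), φ x • h x = 0) :
    h =ᵐ[volume.restrict (Ω : Set ℝ)] 0 := by
  have := Ω.isOpen.ae_eq_zero_of_integral_contDiff_smul_eq_zero (μ := volume.restrict (Ω : Set ℝ))
    (f := h) (hh.locallyIntegrableOn _)
    (fun φ h1 h2 h3 => h0 φ ⟨h1, h2, h3⟩)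
  filter_upwards [this, ae_restrict_mem Ω.isOpen.measurableSet] with x hx hx'
  exact hx hx'

theorem HasWeakDeriv.unique {f g g' : L2 Ω} (h : HasWeakDeriv f g) (h' : HasWeakDeriv f g') :
    g = g' := by
  have key : (fun x => g x - g' x) =ᵐ[volume.restrict (Ω : Set ℝ)] 0 := by
    refine ae_eq_zero_of_test (((Lp.memLp g).locallyIntegrable one_le_two).sub
      ((Lp.memLp g').locallyIntegrable one_le_two)) ?_
    intro φ hφ
    have h1 := h φ hφ
    rw [h' φ hφ, neg_inj] at h1
    simp only [smul_sub]
    rw [integral_sub (hφ.integrable_smul g) (hφ.integrable_smul g'), h1, sub_self]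
  refine Lp.ext ?_
  filter_upwards [key] with x hx
  exact sub_eq_zero.1 hx

/-- A function with zero weak derivative is constant on every interval contained in `Ω`. -/
theorem HasWeakDeriv.ae_const {f : L2 Ω} (h : HasWeakDeriv f 0) {c d : ℝ} (hcd : c < d)
    (hsub : Ioo c d ⊆ (Ω : Set ℝ)) :
    ∃ C : ℂ, ∀ᵐ x ∂(volume.restrict (Ioo c d)), f x = C := by
  let I : Opens ℝ := ⟨Ioo c d, isOpen_Ioo⟩
  have hle : volume.restrict (Ioo c d) ≤ volume.restrict (Ω : Set ℝ) :=
    Measure.restrict_mono hsub le_rfl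
  have hloc : LocallyIntegrable (fun x => f x) (volume.restrict (Ioo c d)) :=
    ((Lp.memLp f).mono_measure hle).locallyIntegrable one_le_two
  have hint {φ : ℝ → ℝ} (hφ : IsTestFunction I φ) (u : ℝ → ℂ)
      (hu : LocallyIntegrable u (volume.restrict (Ioo c d))) :
      Integrable (fun x => φ x • u x) (volume.restrict (Ioo c d)) :=
    hu.integrable_smul_left_of_hasCompactSupport hφ.contDiff.continuous hφ.hasCompactSupport
  -- the hypothesis, with integrals over the interval
  have hI : ∀ φ : ℝ → ℝ, IsTestFunction I φ → ∫ x in Ioo c d, deriv φ x • f x = 0 := by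
    intro φ hφ
    have hφΩ : IsTestFunction Ω φ := ⟨hφ.1, hφ.2, hφ.3.trans hsub⟩
    have h1 := h φ hφΩ
    have e2 : ∫ x in (Ω : Set ℝ), φ x • (0 : L2 Ω) x = 0 := by
      rw [integral_eq_zero_of_ae]
      filter_upwards [Lp.coeFn_zero ℂ 2 (volume.restrict (Ω : Set ℝ))] with x hx
      have hx' : (0 : L2 Ω) x = (0 : ℂ) := hx
      rw [hx', smul_zero, Pi.zero_apply]
    rw [e2, neg_zero] at h1
    rw [← h1]
    refine (setIntegral_eq_of_subset_of_forall_sdiff_eq_zero Ω.isOpen.measurableSet hsub ?_).symm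
    intro x hx
    have : x ∉ tsupport (deriv φ) := fun hx' => hx.2 (hφ.deriv.3 hx')
    simp [image_eq_zero_of_notMem_tsupport this]
  -- a normalised bump function
  obtain ⟨φ₀, hφ₀, hφ₀1⟩ : ∃ φ₀, IsTestFunction I φ₀ ∧ ∫ x, φ₀ x = 1 := by
    let b : ContDiffBump ((c + d) / 2) := ⟨(d - c) / 8, (d - c) / 4, by linarith, by linarith⟩
    refine ⟨b.normed volume, ⟨b.contDiff_normed, b.hasCompactSupport_normed, ?_⟩,
      b.integral_normed⟩
    rw [b.tsupport_normed_eq, Real.closedBall_eq_Icc]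
    intro x hx
    have h1 : b.rOut = (d - c) / 4 := rfl
    rw [h1] at hx
    exact ⟨by linarith [hx.1], by linarith [hx.2]⟩
  refine ⟨∫ x in Ioo c d, φ₀ x • f x, ?_⟩
  set C := ∫ x in Ioo c d, φ₀ x • f x with hC
  have key : (fun x => f x - C) =ᵐ[volume.restrict (I : Set ℝ)] 0 := by
    refine ae_eq_zero_of_test (hloc.sub (locallyIntegrable_const C)) ?_
    intro φ hφ
    set s : ℝ := ∫ x, φ x with hs
    set η : ℝ → ℝ := fun x => φ x - s * φ₀ x with hη
    have hηc : Continuous η := hφ.1.continuous.sub (continuous_const.mul hφ₀.1.continuous)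
    -- the primitive of `η` is a test function
    obtain ⟨c', d', hc', hd', hcd', hz⟩ : ∃ c' d', c < c' ∧ d' < d ∧ c' ≤ d' ∧
        ∀ x, x ∉ Icc c' d' → η x = 0 := by
      set K := tsupport φ ∪ tsupport φ₀ ∪ {(c + d) / 2} with hK
      have hKc : IsCompact K := (hφ.2.isCompact.union hφ₀.2.isCompact).union isCompact_singleton
      have hKI : K ⊆ Ioo c d := by
        refine union_subset (union_subset hφ.3 hφ₀.3) ?_
        rintro x rfl
        exact ⟨by linarith, by linarith⟩
      have hKn : K.Nonempty := ⟨(c + d) / 2, Or.inr rfl⟩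
      refine ⟨sInf K, sSup K, (hKI (hKc.sInf_mem hKn)).1, (hKI (hKc.sSup_mem hKn)).2,
        csInf_le_csSup hKn hKc.bddBelow hKc.bddAbove, fun x hx => ?_⟩
      have hxK : x ∉ K := fun hxK => hx ⟨csInf_le hKc.bddBelow hxK, le_csSup hKc.bddAbove hxK⟩
      have h1 : φ x = 0 := image_eq_zero_of_notMem_tsupport fun h => hxK (Or.inl (Or.inl h))
      have h2 : φ₀ x = 0 := image_eq_zero_of_notMem_tsupport fun h => hxK (Or.inl (Or.inr h))
      simp [hη, h1, h2]
    have hηint : ∫ x, η x = 0 := by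
      rw [hη, integral_sub (hφ.1.continuous.integrable_of_hasCompactSupport hφ.2)
        ((hφ₀.1.continuous.integrable_of_hasCompactSupport hφ₀.2).const_mul s),
        integral_const_mul, hφ₀1, mul_one, sub_self]
    set ψ : ℝ → ℝ := fun x => ∫ t in c'..x, η t with hψ
    have hder : ∀ x, HasDerivAt ψ (η x) x := fun x =>
      (hηc.integral_hasStrictDerivAt c' x).hasDerivAt
    have hderiv : deriv ψ = η := funext fun x => (hder x).deriv
    have hψsupp : Function.support ψ ⊆ Icc c' d' := by
      intro x hx
      by_contra hx'
      apply hx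
      rcases lt_or_ge x c' with h1 | h1
      · rw [hψ]
        simp only
        rw [intervalIntegral.integral_symm, intervalIntegral.integral_of_le h1.le, neg_eq_zero,
          integral_Ioc_eq_integral_Ioo]
        refine setIntegral_eq_zero_of_forall_eq_zero fun t ht => hz t fun h => ?_
        exact absurd h.1 (not_le.2 ht.2)
      · have h2 : d' < x := by
          by_contra h2
          exact hx' ⟨h1, not_lt.1 h2⟩
        rw [hψ]
        simp only
        rw [intervalIntegral.integral_of_le h1, ← integral_Icc_eq_integral_Ioc, ← hηint]
        refine setIntegral_eq_integral_of_forall_compl_eq_zero fun t ht => hz t fun h => ?_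
        exact ht ⟨h.1, h.2.trans h2.le⟩
    have hψts : tsupport ψ ⊆ Icc c' d' := closure_minimal hψsupp isClosed_Icc
    have hψt : IsTestFunction I ψ := by
      refine ⟨?_, HasCompactSupport.of_support_subset_isCompact isCompact_Icc hψsupp,
        hψts.trans fun x hx => ⟨hc'.trans_le hx.1, hx.2.trans_lt hd'⟩⟩
      rw [contDiff_infty_iff_deriv, hderiv]
      exact ⟨fun x => (hder x).differentiableAt, hφ.1.sub (contDiff_const.mul hφ₀.1)⟩
    have h3 := hI ψ hψt
    rw [hderiv] at h3
    have h4 : ∫ x in Ioo c d, η x • f x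
        = (∫ x in Ioo c d, φ x • f x) - s • C := by
      have h6 : Integrable (fun x => s • φ₀ x • f x) (volume.restrict (Ioo c d)) :=
        (hint hφ₀ _ hloc).smul s
      rw [hC, ← integral_smul, ← integral_sub (hint hφ _ hloc) h6]
      refine integral_congr_ae (ae_of_all _ fun x => ?_)
      simp only [hη, sub_smul, mul_smul]
    have h5 : ∫ x in Ioo c d, φ x • C = s • C := by
      rw [integral_smul_const, hs]
      congr 1
      refine setIntegral_eq_integral_of_forall_compl_eq_zero fun x hx => ?_
      exact image_eq_zero_of_notMem_tsupport fun h => hx (hφ.3 h)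
    change ∫ x in Ioo c d, φ x • (f x - C) = 0
    simp only [smul_sub]
    rw [integral_sub (hint hφ _ hloc) (hint hφ _ (locallyIntegrable_const C)), h5, ← h4, h3]
  filter_upwards [key] with x hx
  exact sub_eq_zero.1 hx

end WeakDerivative
/-- The Sobolev space `H¹(Ω)`: the functions in `L²(Ω)` with a weak derivative in `L²(Ω)`. -/
def H1 (Ω : Opens ℝ) : Submodule ℂ (L2 Ω) where
  carrier := {f | ∃ g : L2 Ω, HasWeakDeriv f g}
  add_mem' := fun ⟨_, h⟩ ⟨_, k⟩ => ⟨_, h.add k⟩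
  zero_mem' := ⟨0, HasWeakDeriv.zero⟩
  smul_mem' := fun c _ ⟨_, h⟩ => ⟨_, h.smul c⟩

theorem hasWeakDeriv_choose {Ω : Opens ℝ} (f : H1 Ω) :
    HasWeakDeriv (f : L2 Ω) (Classical.choose f.2) :=
  Classical.choose_spec f.2

/-- The weak derivative `∂ₓ : H¹(Ω) → L²(Ω)`. -/
def weakDeriv (Ω : Opens ℝ) : H1 Ω →ₗ[ℂ] L2 Ω where
  toFun f := Classical.choose f.2
  map_add' f g := (hasWeakDeriv_choose (f + g)).unique
    ((hasWeakDeriv_choose f).add (hasWeakDeriv_choose g))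
  map_smul' c f := (hasWeakDeriv_choose (c • f)).unique ((hasWeakDeriv_choose f).smul c)

theorem hasWeakDeriv_weakDeriv {Ω : Opens ℝ} (f : H1 Ω) :
    HasWeakDeriv (f : L2 Ω) (weakDeriv Ω f) :=
  hasWeakDeriv_choose f

/-- `f(x) = c` for a point `x` of the closure of `Ω`: the class `f` has a representative which is
continuous on the closure of `Ω` and takes the value `c` at `x`. -/
def HasTrace {Ω : Opens ℝ} (f : L2 Ω) (x : ℝ) (c : ℂ) : Prop :=
  ∃ F : ℝ → ℂ, ContinuousOn F (closure (Ω : Set ℝ)) ∧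
    (∀ᵐ y ∂(volume.restrict (Ω : Set ℝ)), f y = F y) ∧ F x = c

section Trace

variable {Ω : Opens ℝ}

theorem HasTrace.add {f g : L2 Ω} {x : ℝ} {c d : ℂ} (h : HasTrace f x c) (k : HasTrace g x d) :
    HasTrace (f + g) x (c + d) := by
  obtain ⟨F, hF, hfF, rfl⟩ := h
  obtain ⟨G, hG, hgG, rfl⟩ := k
  refine ⟨F + G, hF.add hG, ?_, rfl⟩
  filter_upwards [hfF, hgG, Lp.coeFn_add f g] with y h1 h2 h3
  rw [h3, Pi.add_apply, Pi.add_apply, h1, h2]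

theorem HasTrace.smul {f : L2 Ω} {x : ℝ} {c : ℂ} (r : ℂ) (h : HasTrace f x c) :
    HasTrace (r • f) x (r * c) := by
  obtain ⟨F, hF, hfF, rfl⟩ := h
  refine ⟨r • F, hF.const_smul r, ?_, rfl⟩
  filter_upwards [hfF, Lp.coeFn_smul r f] with y h1 h2
  rw [h2, Pi.smul_apply, Pi.smul_apply, h1]

theorem HasTrace.zero (x : ℝ) : HasTrace (0 : L2 Ω) x 0 :=
  ⟨0, continuousOn_const, Lp.coeFn_zero ℂ 2 (volume.restrict (Ω : Set ℝ)), rfl⟩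

theorem HasTrace.eq_of_ae_const {f : L2 Ω} {c d x : ℝ} {v C : ℂ} (h : HasTrace f x v)
    (hcd : c < d) (hsub : Ioo c d ⊆ (Ω : Set ℝ)) (hx : x ∈ Icc c d)
    (hC : ∀ᵐ y ∂(volume.restrict (Ioo c d)), f y = C) : v = C := by
  obtain ⟨F, hF, hfF, rfl⟩ := h
  have hcl : Icc c d ⊆ closure (Ω : Set ℝ) := by
    rw [← closure_Ioo hcd.ne]
    exact closure_mono hsub
  refine Measure.eqOn_Icc_of_ae_eq volume hcd.ne (f := F) (g := fun _ => C) ?_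
    (hF.mono hcl) continuousOn_const hx
  rw [← restrict_Ioo_eq_restrict_Icc]
  filter_upwards [hC, ae_restrict_of_ae_restrict_of_subset hsub hfF] with y h1 h2
  rw [← h2, h1]

end Trace

/-- The parameters of the bar: the physical constants `a, m, k, τ, b > 0` and the points
`0 < L₁ < L₂ < L₃`. -/
structure BarParameters where
  (a m k τ b L₁ L₂ L₃ : ℝ)
  a_pos : 0 < a
  m_pos : 0 < m
  k_pos : 0 < k
  τ_pos : 0 < τ
  b_pos : 0 < b
  L₁_pos : 0 < L₁
  L₁_lt_L₂ : L₁ < L₂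
  L₂_lt_L₃ : L₂ < L₃

/-- The thermoelastic part `(L₁, L₂)`. -/
def BarParameters.inner (p : BarParameters) : Opens ℝ := ⟨Ioo p.L₁ p.L₂, isOpen_Ioo⟩

/-- The elastic part `(0, L₁) ∪ (L₂, L₃)`. -/
def BarParameters.outer (p : BarParameters) : Opens ℝ :=
  ⟨Ioo 0 p.L₁ ∪ Ioo p.L₂ p.L₃, isOpen_Ioo.union isOpen_Ioo⟩

/-- The conditions `v(0) = v(L₃) = 0` and `u(Lᵢ) = v(Lᵢ)`, `i = 1, 2`. -/
structure Matching (p : BarParameters) (u : L2 p.inner) (v : L2 p.outer) : Prop where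
  left : HasTrace v 0 0
  right : HasTrace v p.L₃ 0
  interface₁ : ∃ c, HasTrace u p.L₁ c ∧ HasTrace v p.L₁ c
  interface₂ : ∃ c, HasTrace u p.L₂ c ∧ HasTrace v p.L₂ c

section Matching

variable {p : BarParameters}

theorem Matching.add {u u' : L2 p.inner} {v v' : L2 p.outer} (h : Matching p u v)
    (h' : Matching p u' v') : Matching p (u + u') (v + v') where
  left := by simpa using h.left.add h'.left
  right := by simpa using h.right.add h'.right
  interface₁ := by
    obtain ⟨c, h1, h2⟩ := h.interface₁
    obtain ⟨d, k1, k2⟩ := h'.interface₁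
    exact ⟨c + d, h1.add k1, h2.add k2⟩
  interface₂ := by
    obtain ⟨c, h1, h2⟩ := h.interface₂
    obtain ⟨d, k1, k2⟩ := h'.interface₂
    exact ⟨c + d, h1.add k1, h2.add k2⟩

theorem Matching.zero : Matching p 0 0 where
  left := HasTrace.zero _
  right := HasTrace.zero _
  interface₁ := ⟨0, HasTrace.zero _, HasTrace.zero _⟩
  interface₂ := ⟨0, HasTrace.zero _, HasTrace.zero _⟩

theorem Matching.smul {u : L2 p.inner} {v : L2 p.outer} (r : ℂ) (h : Matching p u v) :
    Matching p (r • u) (r • v) where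
  left := by simpa using h.left.smul r
  right := by simpa using h.right.smul r
  interface₁ := by
    obtain ⟨c, h1, h2⟩ := h.interface₁
    exact ⟨r * c, h1.smul r, h2.smul r⟩
  interface₂ := by
    obtain ⟨c, h1, h2⟩ := h.interface₂
    exact ⟨r * c, h1.smul r, h2.smul r⟩

end Matching

/-- The states `[u¹, v¹, θ, q, u², v²]` as a subspace of
`H¹(L₁,L₂) × H¹((0,L₁) ∪ (L₂,L₃)) × L²(L₁,L₂)³ × L²((0,L₁) ∪ (L₂,L₃))`. -/
def stateSubmodule (p : BarParameters) : Submodule ℂ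
    (H1 p.inner × H1 p.outer × L2 p.inner × L2 p.inner × L2 p.inner × L2 p.outer) where
  carrier := {U | Matching p U.1 U.2.1}
  add_mem' h h' := Matching.add h h'
  zero_mem' := Matching.zero
  smul_mem' r _ h := Matching.smul r h

/-- The state space `𝓗`. Its norm is the energy norm defined below, not the product norm. -/
def StateSpace (p : BarParameters) : Type := stateSubmodule p

namespace StateSpace

variable {p : BarParameters}

instance : AddCommGroup (StateSpace p) := inferInstanceAs (AddCommGroup (stateSubmodule p))

instance : Module ℂ (StateSpace p) := inferInstanceAs (Module ℂ (stateSubmodule p))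

/-- The component `u¹ ∈ H¹(L₁,L₂)`. -/
def u₁ (U : StateSpace p) : H1 p.inner := U.1.1
/-- The component `v¹ ∈ H¹((0,L₁) ∪ (L₂,L₃))`. -/
def v₁ (U : StateSpace p) : H1 p.outer := U.1.2.1
/-- The component `θ ∈ L²(L₁,L₂)`. -/
def θ (U : StateSpace p) : L2 p.inner := U.1.2.2.1
/-- The component `q ∈ L²(L₁,L₂)`. -/
def q (U : StateSpace p) : L2 p.inner := U.1.2.2.2.1
/-- The component `u² ∈ L²(L₁,L₂)`. -/
def u₂ (U : StateSpace p) : L2 p.inner := U.1.2.2.2.2.1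
/-- The component `v² ∈ L²((0,L₁) ∪ (L₂,L₃))`. -/
def v₂ (U : StateSpace p) : L2 p.outer := U.1.2.2.2.2.2

/-- The state with the given components. -/
def mk (u₁ : H1 p.inner) (v₁ : H1 p.outer) (θ q u₂ : L2 p.inner) (v₂ : L2 p.outer)
    (h : Matching p u₁ v₁) : StateSpace p :=
  ⟨(u₁, v₁, θ, q, u₂, v₂), h⟩

theorem matching (U : StateSpace p) : Matching p U.u₁ U.v₁ := U.2

theorem ext {U V : StateSpace p} (h1 : U.u₁ = V.u₁) (h2 : U.v₁ = V.v₁) (h3 : U.θ = V.θ)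
    (h4 : U.q = V.q) (h5 : U.u₂ = V.u₂) (h6 : U.v₂ = V.v₂) : U = V :=
  Subtype.ext (Prod.ext h1 (Prod.ext h2 (Prod.ext h3 (Prod.ext h4 (Prod.ext h5 h6)))))

/-- The energy inner product, conjugate linear in the first argument (`⟪U, V⟫` is
`⟨V, U⟩_𝓗` in the convention where the first argument is the linear one). -/
def energyInner (U V : StateSpace p) : ℂ :=
  (p.a : ℂ) * inner ℂ (weakDeriv _ U.u₁) (weakDeriv _ V.u₁) + inner ℂ U.u₂ V.u₂
    + inner ℂ U.θ V.θ + (p.τ : ℂ) * inner ℂ U.q V.q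
    + (p.b : ℂ) * inner ℂ (weakDeriv _ U.v₁) (weakDeriv _ V.v₁) + inner ℂ U.v₂ V.v₂

/-- Only the zero state has constant displacement on each of the three parts and vanishing other
components. -/
theorem eq_zero_of_weakDeriv_eq_zero {U : StateSpace p} (h1 : weakDeriv _ U.u₁ = 0)
    (h2 : weakDeriv _ U.v₁ = 0) (h3 : U.θ = 0) (h4 : U.q = 0) (h5 : U.u₂ = 0) (h6 : U.v₂ = 0) :
    U = 0 := by
  have du := hasWeakDeriv_weakDeriv U.u₁
  have dv := hasWeakDeriv_weakDeriv U.v₁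
  rw [h1] at du
  rw [h2] at dv
  have s1 : Ioo p.L₁ p.L₂ ⊆ (p.inner : Set ℝ) := subset_rfl
  have s2 : Ioo 0 p.L₁ ⊆ (p.outer : Set ℝ) := subset_union_left
  have s3 : Ioo p.L₂ p.L₃ ⊆ (p.outer : Set ℝ) := subset_union_right
  obtain ⟨C, hC⟩ := du.ae_const p.L₁_lt_L₂ s1
  obtain ⟨D, hD⟩ := dv.ae_const p.L₁_pos s2
  obtain ⟨E, hE⟩ := dv.ae_const p.L₂_lt_L₃ s3
  have m := U.matching
  have hD0 : 0 = D := m.left.eq_of_ae_const p.L₁_pos s2 ⟨le_rfl, p.L₁_pos.le⟩ hD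
  have hE0 : 0 = E := m.right.eq_of_ae_const p.L₂_lt_L₃ s3 ⟨p.L₂_lt_L₃.le, le_rfl⟩ hE
  obtain ⟨c, hc1, hc2⟩ := m.interface₁
  have hcC := hc1.eq_of_ae_const p.L₁_lt_L₂ s1 ⟨le_rfl, p.L₁_lt_L₂.le⟩ hC
  have hcD := hc2.eq_of_ae_const p.L₁_pos s2 ⟨p.L₁_pos.le, le_rfl⟩ hD
  have hC0 : C = 0 := by rw [← hcC, hcD, ← hD0]
  rw [hC0] at hC
  rw [← hD0] at hD
  rw [← hE0] at hE
  refine ext (Subtype.ext (Lp.ext ?_)) (Subtype.ext (Lp.ext ?_)) h3 h4 h5 h6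
  · filter_upwards [show ∀ᵐ x ∂(volume.restrict (p.inner : Set ℝ)), _ from hC,
      Lp.coeFn_zero ℂ 2 (volume.restrict (p.inner : Set ℝ))] with x hx h0
    exact hx.trans h0.symm
  · have hDE : ∀ᵐ x ∂(volume.restrict (p.outer : Set ℝ)), (U.v₁ : L2 p.outer) x = 0 :=
      (ae_restrict_union_iff _ _ _).2 ⟨hD, hE⟩
    filter_upwards [hDE, Lp.coeFn_zero ℂ 2 (volume.restrict (p.outer : Set ℝ))] with x hx h0
    exact hx.trans h0.symm

theorem weakDeriv_u₁_add (U V : StateSpace p) :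
    weakDeriv _ (U + V).u₁ = weakDeriv _ U.u₁ + weakDeriv _ V.u₁ :=
  (weakDeriv _).map_add _ _

theorem weakDeriv_v₁_add (U V : StateSpace p) :
    weakDeriv _ (U + V).v₁ = weakDeriv _ U.v₁ + weakDeriv _ V.v₁ :=
  (weakDeriv _).map_add _ _

theorem weakDeriv_u₁_smul (r : ℂ) (U : StateSpace p) :
    weakDeriv _ (r • U).u₁ = r • weakDeriv _ U.u₁ :=
  (weakDeriv _).map_smul _ _

theorem weakDeriv_v₁_smul (r : ℂ) (U : StateSpace p) :
    weakDeriv _ (r • U).v₁ = r • weakDeriv _ U.v₁ :=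
  (weakDeriv _).map_smul _ _

theorem θ_add (U V : StateSpace p) : (U + V).θ = U.θ + V.θ := rfl
theorem q_add (U V : StateSpace p) : (U + V).q = U.q + V.q := rfl
theorem u₂_add (U V : StateSpace p) : (U + V).u₂ = U.u₂ + V.u₂ := rfl
theorem v₂_add (U V : StateSpace p) : (U + V).v₂ = U.v₂ + V.v₂ := rfl
theorem θ_smul (r : ℂ) (U : StateSpace p) : (r • U).θ = r • U.θ := rfl
theorem q_smul (r : ℂ) (U : StateSpace p) : (r • U).q = r • U.q := rfl
theorem u₂_smul (r : ℂ) (U : StateSpace p) : (r • U).u₂ = r • U.u₂ := rfl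
theorem v₂_smul (r : ℂ) (U : StateSpace p) : (r • U).v₂ = r • U.v₂ := rfl

theorem re_energyInner_self (U : StateSpace p) : (energyInner U U).re =
    p.a * ‖weakDeriv _ U.u₁‖ ^ 2 + ‖U.u₂‖ ^ 2 + ‖U.θ‖ ^ 2 + p.τ * ‖U.q‖ ^ 2
      + p.b * ‖weakDeriv _ U.v₁‖ ^ 2 + ‖U.v₂‖ ^ 2 := by
  have h : energyInner U U = ((p.a * ‖weakDeriv _ U.u₁‖ ^ 2 + ‖U.u₂‖ ^ 2 + ‖U.θ‖ ^ 2
      + p.τ * ‖U.q‖ ^ 2 + p.b * ‖weakDeriv _ U.v₁‖ ^ 2 + ‖U.v₂‖ ^ 2 : ℝ) : ℂ) := by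
    simp only [energyInner, inner_self_eq_norm_sq_to_K]
    push_cast
    rfl
  rw [h, Complex.ofReal_re]

/-- The energy inner product is an inner product. -/
@[reducible]
def energyCore (p : BarParameters) : InnerProductSpace.Core ℂ (StateSpace p) where
  inner := energyInner
  conj_inner_symm U V := by
    simp only [energyInner, map_add, map_mul, inner_conj_symm, Complex.conj_ofReal]
  re_inner_nonneg U := by
    have := p.a_pos
    have := p.τ_pos
    have := p.b_pos
    change 0 ≤ (energyInner U U).re
    rw [re_energyInner_self]
    positivity
  add_left U V W := by
    simp only [energyInner, weakDeriv_u₁_add, weakDeriv_v₁_add, θ_add, q_add, u₂_add, v₂_add,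
      inner_add_left]
    ring
  smul_left U V r := by
    simp only [energyInner, weakDeriv_u₁_smul, weakDeriv_v₁_smul, θ_smul, q_smul, u₂_smul,
      v₂_smul, inner_smul_left]
    ring
  definite U h := by
    have h0 : (energyInner U U).re = 0 := by
      rw [show energyInner U U = 0 from h, Complex.zero_re]
    rw [re_energyInner_self] at h0
    have ha := p.a_pos
    have ht := p.τ_pos
    have hb := p.b_pos
    have i1 : 0 ≤ p.a * ‖weakDeriv _ U.u₁‖ ^ 2 := by positivity
    have i2 : 0 ≤ ‖U.u₂‖ ^ 2 := by positivity
    have i3 : 0 ≤ ‖U.θ‖ ^ 2 := by positivity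
    have i4 : 0 ≤ p.τ * ‖U.q‖ ^ 2 := by positivity
    have i5 : 0 ≤ p.b * ‖weakDeriv _ U.v₁‖ ^ 2 := by positivity
    have i6 : 0 ≤ ‖U.v₂‖ ^ 2 := by positivity
    have j1 : p.a * ‖weakDeriv _ U.u₁‖ ^ 2 = 0 := by linarith
    have j2 : ‖U.u₂‖ ^ 2 = 0 := by linarith
    have j3 : ‖U.θ‖ ^ 2 = 0 := by linarith
    have j4 : p.τ * ‖U.q‖ ^ 2 = 0 := by linarith
    have j5 : p.b * ‖weakDeriv _ U.v₁‖ ^ 2 = 0 := by linarith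
    have j6 : ‖U.v₂‖ ^ 2 = 0 := by linarith
    exact eq_zero_of_weakDeriv_eq_zero (by simpa [ha.ne'] using j1) (by simpa [hb.ne'] using j5)
      (by simpa using j3) (by simpa [ht.ne'] using j4) (by simpa using j2) (by simpa using j6)

instance : NormedAddCommGroup (StateSpace p) := (energyCore p).toNormedAddCommGroup

instance : InnerProductSpace ℂ (StateSpace p) :=
  InnerProductSpace.ofCore (energyCore p).toCore

end StateSpace

/-- The domain `D(𝓐)`: the states with `u¹, v¹` in `H²`, with `θ, q, u², v²` in `H¹`, with
`v²(0) = v²(L₃) = 0` and, for `i = 1, 2`, `u²(Lᵢ) = v²(Lᵢ)`, `q(Lᵢ) = 0` and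
`a u¹ₓ(Lᵢ) - m θ(Lᵢ) = b v¹ₓ(Lᵢ)`. -/
structure InDomain (p : BarParameters) (U : StateSpace p) : Prop where
  u₁_H2 : weakDeriv _ U.u₁ ∈ H1 p.inner
  v₁_H2 : weakDeriv _ U.v₁ ∈ H1 p.outer
  θ_H1 : U.θ ∈ H1 p.inner
  q_H1 : U.q ∈ H1 p.inner
  u₂_H1 : U.u₂ ∈ H1 p.inner
  v₂_H1 : U.v₂ ∈ H1 p.outer
  matching : Matching p U.u₂ U.v₂
  q_trace : ∀ x ∈ ({p.L₁, p.L₂} : Set ℝ), HasTrace U.q x 0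
  transmission : ∀ x ∈ ({p.L₁, p.L₂} : Set ℝ), ∃ r s t : ℂ,
    HasTrace (weakDeriv _ U.u₁) x r ∧ HasTrace U.θ x s ∧ HasTrace (weakDeriv _ U.v₁) x t ∧
      p.a * r - p.m * s = p.b * t

/-- `D(𝓐)` as a subspace of `𝓗`. -/
def generatorDomain (p : BarParameters) : Submodule ℂ (StateSpace p) where
  carrier := {U | InDomain p U}
  add_mem' := by
    intro U V h k
    refine ⟨?_, ?_, add_mem h.θ_H1 k.θ_H1, add_mem h.q_H1 k.q_H1, add_mem h.u₂_H1 k.u₂_H1,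
      add_mem h.v₂_H1 k.v₂_H1, h.matching.add k.matching, fun x hx => ?_, fun x hx => ?_⟩
    · rw [StateSpace.weakDeriv_u₁_add]
      exact add_mem h.u₁_H2 k.u₁_H2
    · rw [StateSpace.weakDeriv_v₁_add]
      exact add_mem h.v₁_H2 k.v₁_H2
    · rw [StateSpace.q_add]
      simpa using (h.q_trace x hx).add (k.q_trace x hx)
    · obtain ⟨r, s, t, h1, h2, h3, h4⟩ := h.transmission x hx
      obtain ⟨r', s', t', k1, k2, k3, k4⟩ := k.transmission x hx
      rw [StateSpace.weakDeriv_u₁_add, StateSpace.weakDeriv_v₁_add]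
      exact ⟨r + r', s + s', t + t', h1.add k1, h2.add k2, h3.add k3, by
        linear_combination h4 + k4⟩
  zero_mem' := by
    have e1 : weakDeriv _ (0 : StateSpace p).u₁ = 0 := (weakDeriv _).map_zero
    have e2 : weakDeriv _ (0 : StateSpace p).v₁ = 0 := (weakDeriv _).map_zero
    refine ⟨?_, ?_, zero_mem _, zero_mem _, zero_mem _, zero_mem _, Matching.zero,
      fun x _ => HasTrace.zero x, fun x _ => ?_⟩
    · rw [e1]
      exact zero_mem _
    · rw [e2]
      exact zero_mem _
    · rw [e1, e2]
      exact ⟨0, 0, 0, HasTrace.zero x, HasTrace.zero x, HasTrace.zero x, by simp⟩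
  smul_mem' := by
    intro c U h
    refine ⟨?_, ?_, Submodule.smul_mem _ c h.θ_H1, Submodule.smul_mem _ c h.q_H1,
      Submodule.smul_mem _ c h.u₂_H1, Submodule.smul_mem _ c h.v₂_H1, h.matching.smul c,
      fun x hx => ?_, fun x hx => ?_⟩
    · rw [StateSpace.weakDeriv_u₁_smul]
      exact Submodule.smul_mem _ c h.u₁_H2
    · rw [StateSpace.weakDeriv_v₁_smul]
      exact Submodule.smul_mem _ c h.v₁_H2
    · rw [StateSpace.q_smul]
      simpa using (h.q_trace x hx).smul c
    · obtain ⟨r, s, t, h1, h2, h3, h4⟩ := h.transmission x hx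
      rw [StateSpace.weakDeriv_u₁_smul, StateSpace.weakDeriv_v₁_smul]
      exact ⟨c * r, c * s, c * t, h1.smul c, h2.smul c, h3.smul c, by
        linear_combination c * h4⟩

namespace generatorDomain

/-- The component `u¹ₓ` of a state in `D(𝓐)`, as an element of `H¹`. -/
def du₁ (p : BarParameters) : generatorDomain p →ₗ[ℂ] H1 p.inner where
  toFun U := ⟨weakDeriv _ U.1.u₁, U.2.u₁_H2⟩
  map_add' _ _ := Subtype.ext (StateSpace.weakDeriv_u₁_add _ _)
  map_smul' _ _ := Subtype.ext (StateSpace.weakDeriv_u₁_smul _ _)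

/-- The component `v¹ₓ` of a state in `D(𝓐)`, as an element of `H¹`. -/
def dv₁ (p : BarParameters) : generatorDomain p →ₗ[ℂ] H1 p.outer where
  toFun U := ⟨weakDeriv _ U.1.v₁, U.2.v₁_H2⟩
  map_add' _ _ := Subtype.ext (StateSpace.weakDeriv_v₁_add _ _)
  map_smul' _ _ := Subtype.ext (StateSpace.weakDeriv_v₁_smul _ _)

/-- The component `θ` of a state in `D(𝓐)`, as an element of `H¹`. -/
def θ (p : BarParameters) : generatorDomain p →ₗ[ℂ] H1 p.inner where
  toFun U := ⟨U.1.θ, U.2.θ_H1⟩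
  map_add' _ _ := Subtype.ext (StateSpace.θ_add _ _)
  map_smul' _ _ := Subtype.ext (StateSpace.θ_smul _ _)

/-- The component `q` of a state in `D(𝓐)`, as an element of `H¹`. -/
def q (p : BarParameters) : generatorDomain p →ₗ[ℂ] H1 p.inner where
  toFun U := ⟨U.1.q, U.2.q_H1⟩
  map_add' _ _ := Subtype.ext (StateSpace.q_add _ _)
  map_smul' _ _ := Subtype.ext (StateSpace.q_smul _ _)

/-- The component `u²` of a state in `D(𝓐)`, as an element of `H¹`. -/
def u₂ (p : BarParameters) : generatorDomain p →ₗ[ℂ] H1 p.inner where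
  toFun U := ⟨U.1.u₂, U.2.u₂_H1⟩
  map_add' _ _ := Subtype.ext (StateSpace.u₂_add _ _)
  map_smul' _ _ := Subtype.ext (StateSpace.u₂_smul _ _)

/-- The component `v²` of a state in `D(𝓐)`, as an element of `H¹`. -/
def v₂ (p : BarParameters) : generatorDomain p →ₗ[ℂ] H1 p.outer where
  toFun U := ⟨U.1.v₂, U.2.v₂_H1⟩
  map_add' _ _ := Subtype.ext (StateSpace.v₂_add _ _)
  map_smul' _ _ := Subtype.ext (StateSpace.v₂_smul _ _)

/-- The component `-(k q + m u²)ₓ` of `𝓐U`. -/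
def image₃ (p : BarParameters) : generatorDomain p →ₗ[ℂ] L2 p.inner :=
  -(weakDeriv p.inner ∘ₗ ((p.k : ℂ) • q p + (p.m : ℂ) • u₂ p))

/-- The component `-(k/τ) θₓ - (1/τ) q` of `𝓐U`. -/
def image₄ (p : BarParameters) : generatorDomain p →ₗ[ℂ] L2 p.inner :=
  -((p.k / p.τ : ℂ) • weakDeriv p.inner ∘ₗ θ p) - (1 / p.τ : ℂ) • (H1 p.inner).subtype ∘ₗ q p

/-- The component `(a u¹ₓ - m θ)ₓ` of `𝓐U`. -/
def image₅ (p : BarParameters) : generatorDomain p →ₗ[ℂ] L2 p.inner :=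
  weakDeriv p.inner ∘ₗ ((p.a : ℂ) • du₁ p - (p.m : ℂ) • θ p)

/-- The component `b v¹ₓₓ` of `𝓐U`. -/
def image₆ (p : BarParameters) : generatorDomain p →ₗ[ℂ] L2 p.outer :=
  (p.b : ℂ) • weakDeriv p.outer ∘ₗ dv₁ p

end generatorDomain

open generatorDomain in
/-- The unbounded operator `𝓐 : 𝓗 ⊇ D(𝓐) → 𝓗`,
`𝓐U = [u², v², -(k q + m u²)ₓ, -(k/τ) θₓ - (1/τ) q, (a u¹ₓ - m θ)ₓ, b v¹ₓₓ]`. -/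
def generator (p : BarParameters) : StateSpace p →ₗ.[ℂ] StateSpace p where
  domain := generatorDomain p
  toFun :=
    { toFun := fun U => StateSpace.mk (u₂ p U) (v₂ p U) (image₃ p U) (image₄ p U) (image₅ p U)
        (image₆ p U) U.2.matching
      map_add' := fun U V => StateSpace.ext ((u₂ p).map_add U V) ((v₂ p).map_add U V)
        ((image₃ p).map_add U V) ((image₄ p).map_add U V) ((image₅ p).map_add U V)
        ((image₆ p).map_add U V)
      map_smul' := fun c U => StateSpace.ext ((u₂ p).map_smul c U) ((v₂ p).map_smul c U)
        ((image₃ p).map_smul c U) ((image₄ p).map_smul c U) ((image₅ p).map_smul c U)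
        ((image₆ p).map_smul c U) }

section Operator

variable {E : Type*} [NormedAddCommGroup E] [NormedSpace ℂ E]

/-- `z` is in the resolvent set of the unbounded operator `T`: the operator `z - T : D(T) → E` has
an everywhere defined bounded two-sided inverse `R`. -/
def opResolventSet (T : E →ₗ.[ℂ] E) : Set ℂ :=
  {z | ∃ R : E →L[ℂ] E,
    (∀ f : E, ∃ h : R f ∈ T.domain, z • R f - T ⟨R f, h⟩ = f) ∧
    ∀ u : T.domain, R (z • (u : E) - T u) = u}

/-- The spectrum of an unbounded operator. -/
def opSpectrum (T : E →ₗ.[ℂ] E) : Set ℂ := (opResolventSet T)ᶜ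

/-- The point spectrum (the set of eigenvalues) of an unbounded operator. -/
def opPointSpectrum (T : E →ₗ.[ℂ] E) : Set ℂ :=
  {z | ∃ u : T.domain, u ≠ 0 ∧ T u = z • (u : E)}

/-- The kernel of an unbounded operator, as a subspace of the whole space. -/
def opKernel (T : E →ₗ.[ℂ] E) : Submodule ℂ E := T.toFun.ker.map T.domain.subtype

/-- `U` is a classical solution of `U' = T U` on `[0, ∞)`, `U 0 = U₀`: it is continuous with
values in `D(T)` (for the graph norm), continuously differentiable with values in `E`, and satisfies
the equation. -/
structure IsClassicalSolution (T : E →ₗ.[ℂ] E) (U₀ : E) (U : ℝ → E) : Prop where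
  initial : U 0 = U₀
  continuousOn : ContinuousOn U (Ici 0)
  exists_deriv : ∃ V : ℝ → E, ContinuousOn V (Ici 0) ∧ ∀ t ∈ Ici (0 : ℝ),
    HasDerivWithinAt U (V t) (Ici 0) t ∧ ∃ h : U t ∈ T.domain, V t = T ⟨U t, h⟩

/-- `U₀` is a stationary solution of `U' = T U`. -/
def IsStationarySolution (T : E →ₗ.[ℂ] E) (U₀ : E) : Prop :=
  IsClassicalSolution T U₀ fun _ => U₀

end Operator

/-- The function `ζ¹` on `(L₁, L₂)`. -/
def zeta₁ (p : BarParameters) (x : ℝ) : ℝ :=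
  (p.L₂ - p.L₁ - p.L₃) / (p.L₁ * p.L₃) * x + 1

/-- The function `ζ²` on `[0, L₁] ∪ [L₂, L₃]`. -/
def zeta₂ (p : BarParameters) (x : ℝ) : ℝ :=
  if x ≤ p.L₁ then (p.L₂ - p.L₁) / (p.L₁ * p.L₃) * x
  else (p.L₂ - p.L₁) / (p.L₁ * p.L₃) * x - (p.L₂ - p.L₁) / p.L₁

/-- The constant `ζ³`. -/
def zeta₃ (p : BarParameters) : ℝ :=
  (p.a * (p.L₂ - p.L₁ - p.L₃) - p.b * (p.L₂ - p.L₁)) / (p.m * p.L₁ * p.L₃)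

/-- `Z` is the state `[ζ¹, ζ², ζ³, 0, 0, 0]`. -/
structure IsZeta (p : BarParameters) (Z : StateSpace p) : Prop where
  u₁ : ∀ᵐ x ∂(volume.restrict (p.inner : Set ℝ)), (Z.u₁ : L2 p.inner) x = zeta₁ p x
  v₁ : ∀ᵐ x ∂(volume.restrict (p.outer : Set ℝ)), (Z.v₁ : L2 p.outer) x = zeta₂ p x
  θ : ∀ᵐ x ∂(volume.restrict (p.inner : Set ℝ)), Z.θ x = zeta₃ p
  q : Z.q = 0
  u₂ : Z.u₂ = 0
  v₂ : Z.v₂ = 0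

end ThermoelasticBar

end

open ThermoelasticBar

/-!
The operator `𝓐` is dissipative: `re ⟪U, 𝓐 U⟫ = -‖q‖²` (`re_inner_generator`), because all boundary
terms of the integrations by parts cancel through the boundary and transmission conditions. From
this the resolvent statement follows in three steps.

*Injectivity.* Let `𝓐 U = z U` with `z ≠ 0` and `re z ≥ 0`. Dissipation gives `q = 0`, so `θ` is
constant and `θ = -m u¹ₓ`; the momentum equation then gives `u² = 0`, hence `u¹ = θ = 0`. No
displacement and no stress is transmitted to the outer part, where `v¹` solves a second order
equation with zero Cauchy data at `L₁` and at `L₂`, so `v¹ = 0` (`eq_zero_of_generator_eq_smul`).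

*Surjectivity.* The equation `(z - 𝓐) U = F` is a first order linear system with constant
coefficients for `(u, a uₓ - m θ, θ, q)` on `(L₁, L₂)` and for `(v, b vₓ)` on the outer intervals.
It is solved from left to right, with the stress at `0` and the temperature at `L₁` as free
parameters; two scalar conditions, `q(L₂) = 0` and `v(L₃) = 0`, are left over. They form a `2 × 2`
linear system, and this is invertible because `z - 𝓐` is injective (`exists_sub_generator_eq`).

*Boundedness.* For `z = 1` dissipativity bounds the inverse. For the other `z` the bounded bijection
`(z - 𝓐)(1 - 𝓐)⁻¹ = 1 + (z - 1)(1 - 𝓐)⁻¹` of the complete space `𝓗` has a bounded inverse by the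
open mapping theorem (`mem_opResolventSet_of_bijective`).

In the kernel of `𝓐` the velocities and the heat flux vanish, the temperature and the strains are
constant, and the stress is the same constant on the whole bar; the boundary conditions leave one
free constant (`mem_span_of_generator_eq_zero`).

Weak derivatives are handled through absolutely continuous representatives (`IsPrimitive`). A pair
`(u, v)` subject to the matching conditions is the same thing as an absolutely continuous function
on `[0, L₃]` vanishing at both ends (`IsProfile`), so that `𝓗` is isomorphic to the closed subspace
of a product of `L²` spaces given by `∫ u¹ₓ + ∫ v¹ₓ = 0`. Hence it is complete.
-/

namespace ThermoelasticBar

/-! ### Primitives of integrable functions on an interval -/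

/-- `F` is a primitive of the integrable function `g` on the nondegenerate interval `[c, d]`, that
is, `F` is absolutely continuous there and `F' = g` almost everywhere. -/
structure IsPrimitive (F g : ℝ → ℂ) (c d : ℝ) : Prop where
  lt : c < d
  integrable : IntervalIntegrable g volume c d
  eq : ∀ x ∈ Icc c d, F x = F c + ∫ t in c..x, g t

namespace IsPrimitive

variable {F G f g : ℝ → ℂ} {c d : ℝ}

theorem intervalIntegrable (h : IsPrimitive F g c d) {x : ℝ} (hx : x ∈ Icc c d) :
    IntervalIntegrable g volume c x := by
  refine h.integrable.mono_set ?_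
  rw [uIcc_of_le hx.1, uIcc_of_le h.lt.le]
  exact Icc_subset_Icc_right hx.2

theorem continuousOn (h : IsPrimitive F g c d) : ContinuousOn F (Icc c d) := by
  have hi : IntegrableOn g (uIcc c d) volume := by
    rw [uIcc_of_le h.lt.le, integrableOn_Icc_iff_integrableOn_Ioc]
    exact h.integrable.1
  have h1 := intervalIntegral.continuousOn_primitive_interval hi
  rw [uIcc_of_le h.lt.le] at h1
  exact (continuousOn_const.add h1).congr h.eq

theorem congr_ae (h : IsPrimitive F g c d) (hg : ∀ᵐ x ∂(volume.restrict (Ioo c d)), g x = f x) :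
    IsPrimitive F f c d := by
  have hg' : ∀ᵐ x ∂(volume.restrict (Ioc c d)), g x = f x := by
    rwa [← restrict_Ioo_eq_restrict_Ioc]
  refine ⟨h.lt, ?_, fun x hx => ?_⟩
  · rw [intervalIntegrable_iff_integrableOn_Ioc_of_le h.lt.le]
    exact h.integrable.1.congr hg'
  · rw [h.eq x hx]
    congr 1
    refine intervalIntegral.integral_congr_ae_restrict ?_
    rw [uIoc_of_le hx.1]
    exact ae_restrict_of_ae_restrict_of_subset (Ioc_subset_Ioc_right hx.2) hg'

theorem add (hF : IsPrimitive F f c d) (hG : IsPrimitive G g c d) :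
    IsPrimitive (fun x => F x + G x) (fun x => f x + g x) c d := by
  refine ⟨hF.lt, hF.integrable.add hG.integrable, fun x hx => ?_⟩
  rw [intervalIntegral.integral_add (hF.intervalIntegrable hx) (hG.intervalIntegrable hx),
    hF.eq x hx, hG.eq x hx]
  ring

theorem const_mul (r : ℂ) (hF : IsPrimitive F f c d) :
    IsPrimitive (fun x => r * F x) (fun x => r * f x) c d := by
  refine ⟨hF.lt, hF.integrable.const_mul r, fun x hx => ?_⟩
  rw [intervalIntegral.integral_const_mul, hF.eq x hx]
  ring

theorem conj (hF : IsPrimitive F f c d) :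
    IsPrimitive (fun x => starRingEnd ℂ (F x)) (fun x => starRingEnd ℂ (f x)) c d := by
  refine ⟨hF.lt, ?_, fun x hx => ?_⟩
  · rw [intervalIntegrable_iff_integrableOn_Ioc_of_le hF.lt.le]
    exact (Complex.conjCLE.toContinuousLinearMap.integrable_comp hF.integrable.1 :)
  · have := Complex.conjCLE.toContinuousLinearMap.intervalIntegral_comp_comm
      (hF.intervalIntegrable hx)
    rw [hF.eq x hx, map_add]
    exact congrArg _ this.symm

theorem of_hasDerivAt (hcd : c < d) (hF : ∀ x ∈ Icc c d, HasDerivAt F (f x) x)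
    (hf : ContinuousOn f (Icc c d)) : IsPrimitive F f c d := by
  have hi : IntervalIntegrable f volume c d := hf.intervalIntegrable_of_Icc hcd.le
  refine ⟨hcd, hi, fun x hx => ?_⟩
  rw [intervalIntegral.integral_eq_sub_of_hasDerivAt (f := F)]
  · ring
  · rw [uIcc_of_le hx.1]
    exact fun y hy => hF y ⟨hy.1, hy.2.trans hx.2⟩
  · exact (hf.mono (Icc_subset_Icc_right hx.2)).intervalIntegrable_of_Icc hx.1

theorem integral (hcd : c < d) (hg : IntervalIntegrable g volume c d) (C : ℂ) :
    IsPrimitive (fun x => C + ∫ t in c..x, g t) g c d :=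
  ⟨hcd, hg, fun x _ => by simp⟩

theorem affine (hcd : c < d) (r s : ℂ) : IsPrimitive (fun x => r * x + s) (fun _ => r) c d := by
  refine of_hasDerivAt hcd (fun x _ => ?_) continuousOn_const
  simpa using ((Complex.ofRealCLM.hasDerivAt (x := x)).const_mul r).add_const s

/-- Integration by parts. The two double integrals over the triangles `t ≤ x` and `x ≤ t` add up to
the integral over the square. -/
theorem integral_mul (hF : IsPrimitive F f c d) (hG : IsPrimitive G g c d) :
    ∫ x in Ioo c d, (f x * G x + F x * g x) = F d * G d - F c * G c := by
  have hcd := hF.lt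
  set μ := volume.restrict (Ioo c d) with hμ
  have hf : Integrable f μ :=
    (intervalIntegrable_iff_integrableOn_Ioo_of_le hcd.le).1 hF.integrable
  have hg : Integrable g μ :=
    (intervalIntegrable_iff_integrableOn_Ioo_of_le hcd.le).1 hG.integrable
  set T : ℝ → ℝ → ℂ := fun x t => if t ≤ x then f x * g t else 0
  set S : ℝ → ℝ → ℂ := fun x t => if x ≤ t then f x * g t else 0
  have hfg : Integrable (fun z : ℝ × ℝ => f z.1 * g z.2) (μ.prod μ) := hf.mul_prod hg
  have hTi : Integrable (Function.uncurry T) (μ.prod μ) := by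
    have := hfg.indicator (measurableSet_le measurable_snd measurable_fst)
    refine this.congr (ae_of_all _ fun z => ?_)
    simp [T, Function.uncurry, Set.indicator]
  have hSi : Integrable (Function.uncurry S) (μ.prod μ) := by
    have := hfg.indicator (measurableSet_le measurable_fst measurable_snd)
    refine this.congr (ae_of_all _ fun z => ?_)
    simp [S, Function.uncurry, Set.indicator]
  have key (h : ℝ → ℂ) {x : ℝ} (hx : x ∈ Ioo c d) :
      ∫ t in c..x, h t = ∫ t, (if t ≤ x then h t else 0) ∂μ := by
    rw [intervalIntegral.integral_of_le hx.1.le]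
    have : (fun t => if t ≤ x then h t else 0) = (Iic x).indicator h := by
      ext t; simp [Set.indicator]
    rw [this, integral_indicator measurableSet_Iic, hμ, Measure.restrict_restrict measurableSet_Iic]
    congr 2
    ext t
    simp only [mem_Ioc, mem_inter_iff, mem_Iic, mem_Ioo]
    constructor
    · rintro ⟨h1, h2⟩
      exact ⟨h2, h1, h2.trans_lt hx.2⟩
    · rintro ⟨h1, h2, -⟩
      exact ⟨h2, h1⟩
  have key' (h : ℝ → ℂ) : ∫ t in c..d, h t = ∫ t, h t ∂μ := by
    rw [intervalIntegral.integral_of_le hcd.le, integral_Ioc_eq_integral_Ioo]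
  have hmem : ∀ᵐ x ∂μ, x ∈ Ioo c d := ae_restrict_mem measurableSet_Ioo
  have iT : Integrable (fun x => ∫ t, T x t ∂μ) μ := hTi.integral_prod_left
  have iS : Integrable (fun x => ∫ t, S x t ∂μ) μ := hSi.integral_prod_left
  have iS' : Integrable (fun x => ∫ t, S t x ∂μ) μ := hSi.swap.integral_prod_left
  have a1 : (fun x => G c * f x + ∫ t, T x t ∂μ) =ᵐ[μ] fun x => f x * G x := by
    filter_upwards [hmem] with x hx
    have : ∫ t, T x t ∂μ = f x * ∫ t in c..x, g t := by
      rw [key g hx, ← integral_const_mul]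
      exact integral_congr_ae (ae_of_all _ fun t => by simp [T])
    rw [this, hG.eq x (Ioo_subset_Icc_self hx)]
    ring
  have a2 : (fun x => F c * g x + ∫ t, S t x ∂μ) =ᵐ[μ] fun x => F x * g x := by
    filter_upwards [hmem] with x hx
    have : ∫ t, S t x ∂μ = g x * ∫ t in c..x, f t := by
      rw [key f hx, ← integral_const_mul]
      exact integral_congr_ae (ae_of_all _ fun t => by simp [S, mul_comm])
    rw [this, hF.eq x (Ioo_subset_Icc_self hx)]
    ring
  have e1 : ∫ x, f x * G x ∂μ = G c * (∫ x, f x ∂μ) + ∫ x, ∫ t, T x t ∂μ ∂μ := by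
    rw [← integral_const_mul, ← integral_add (hf.const_mul _) iT]
    exact integral_congr_ae a1.symm
  have e2 : ∫ x, F x * g x ∂μ = F c * (∫ x, g x ∂μ) + ∫ x, ∫ t, S t x ∂μ ∂μ := by
    rw [← integral_const_mul, ← integral_add (hg.const_mul _) iS']
    exact integral_congr_ae a2.symm
  have e3 : (∫ x, ∫ t, T x t ∂μ ∂μ) + ∫ x, ∫ t, S t x ∂μ ∂μ = (∫ x, f x ∂μ) * ∫ x, g x ∂μ := by
    rw [← integral_integral_swap hSi, ← integral_add iT iS, ← integral_mul_const]
    refine integral_congr_ae ?_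
    filter_upwards [hTi.prod_right_ae, hSi.prod_right_ae] with x h1 h2
    change (∫ t, T x t ∂μ) + ∫ t, S x t ∂μ = f x * ∫ x, g x ∂μ
    replace h1 : Integrable (fun t => T x t) μ := h1
    replace h2 : Integrable (fun t => S x t) μ := h2
    rw [← integral_add h1 h2, ← integral_const_mul]
    refine integral_congr_ae ?_
    -- the diagonal is negligible
    have hne : ∀ᵐ t ∂μ, t ≠ x :=
      ae_restrict_of_ae (by simp [ae_iff])
    filter_upwards [hne] with t ht
    change T x t + S x t = f x * g t
    rcases lt_or_gt_of_ne ht with h | h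
    · simp [T, S, h.le, not_le.2 h]
    · simp [T, S, h.le, not_le.2 h]
  have iF : Integrable (fun x => f x * G x) μ := ((hf.const_mul _).add iT).congr a1
  have iG : Integrable (fun x => F x * g x) μ := ((hg.const_mul _).add iS').congr a2
  rw [integral_add iF iG, e1, e2, hF.eq d ⟨hcd.le, le_rfl⟩, hG.eq d ⟨hcd.le, le_rfl⟩, key', key']
  linear_combination e3

end IsPrimitive

/-! ### Absolutely continuous representatives of Sobolev functions -/

section Sobolev

variable {Ω : Opens ℝ} {c d : ℝ}

theorem weakDeriv_eq {f : H1 Ω} {g : L2 Ω} (h : HasWeakDeriv (f : L2 Ω) g) : weakDeriv Ω f = g :=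
  (hasWeakDeriv_weakDeriv f).unique h

theorem HasWeakDeriv.mem_H1 {f g : L2 Ω} (h : HasWeakDeriv f g) : f ∈ H1 Ω := ⟨g, h⟩

theorem memLp_Ioo (f : L2 Ω) (hsub : Ioo c d ⊆ (Ω : Set ℝ)) :
    MemLp f 2 (volume.restrict (Ioo c d)) :=
  (Lp.memLp f).mono_measure (Measure.restrict_mono hsub le_rfl)

theorem integrable_Ioo (f : L2 Ω) (hsub : Ioo c d ⊆ (Ω : Set ℝ)) :
    Integrable f (volume.restrict (Ioo c d)) :=
  (memLp_Ioo f hsub).integrable one_le_two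

theorem intervalIntegrable_of_Ioo_subset (f : L2 Ω) (hcd : c ≤ d) (hsub : Ioo c d ⊆ (Ω : Set ℝ)) :
    IntervalIntegrable f volume c d :=
  (intervalIntegrable_iff_integrableOn_Ioo_of_le hcd).2 (integrable_Ioo f hsub)

theorem ContinuousOn.memLp_Ioo {F : ℝ → ℂ} (hF : ContinuousOn F (Icc c d)) :
    MemLp F 2 (volume.restrict (Ioo c d)) := by
  obtain ⟨C, hC⟩ := isCompact_Icc.exists_bound_of_continuousOn hF
  refine MemLp.of_bound ((hF.mono Ioo_subset_Icc_self).aestronglyMeasurable measurableSet_Ioo) C ?_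
  filter_upwards [ae_restrict_mem measurableSet_Ioo] with x hx
  exact hC x (Ioo_subset_Icc_self hx)

theorem IsTestFunction.isPrimitive {φ : ℝ → ℝ} (hφ : IsTestFunction Ω φ) (hcd : c < d) :
    IsPrimitive (fun x => (φ x : ℂ)) (fun x => ((_root_.deriv φ x : ℝ) : ℂ)) c d := by
  refine IsPrimitive.of_hasDerivAt hcd (fun x _ => ?_)
    (Complex.continuous_ofReal.comp hφ.deriv.1.continuous).continuousOn
  exact ((hφ.1.differentiable (by simp) x).hasDerivAt).ofReal_comp

theorem IsTestFunction.eq_zero {φ : ℝ → ℝ} (hφ : IsTestFunction Ω φ) {x : ℝ}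
    (hx : x ∉ (Ω : Set ℝ)) : φ x = 0 :=
  image_eq_zero_of_notMem_tsupport fun h => hx (hφ.3 h)

/-- Testing an absolutely continuous function on a component `(c, d)` of `Ω`. -/
theorem IsPrimitive.integral_test {F g : ℝ → ℂ} (hF : IsPrimitive F g c d) {φ : ℝ → ℝ}
    (hφ : IsTestFunction Ω φ) (hc : c ∉ (Ω : Set ℝ)) (hd : d ∉ (Ω : Set ℝ)) :
    ∫ x in Ioo c d, deriv φ x • F x = - ∫ x in Ioo c d, φ x • g x := by
  have h := (hφ.isPrimitive hF.lt).integral_mul hF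
  rw [hφ.eq_zero hc, hφ.eq_zero hd, Complex.ofReal_zero, zero_mul, zero_mul, sub_zero] at h
  have hg : Integrable g (volume.restrict (Ioo c d)) :=
    (intervalIntegrable_iff_integrableOn_Ioo_of_le hF.lt.le).1 hF.integrable
  have i1 : Integrable (fun x => deriv φ x • F x) (volume.restrict (Ioo c d)) := by
    have : ContinuousOn (fun x => deriv φ x • F x) (Icc c d) :=
      hφ.deriv.1.continuous.continuousOn.smul hF.continuousOn
    exact this.integrableOn_Icc.mono_set Ioo_subset_Icc_self
  have i2 : Integrable (fun x => φ x • g x) (volume.restrict (Ioo c d)) :=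
    hg.locallyIntegrable.integrable_smul_left_of_hasCompactSupport
      hφ.contDiff.continuous hφ.hasCompactSupport
  rw [eq_neg_iff_add_eq_zero, ← integral_add i1 i2, ← h]
  simp only [Complex.real_smul]

/-- A Sobolev function on `Ω` is absolutely continuous on every interval contained in `Ω`: it
differs from the primitive of its derivative by a function with zero weak derivative. -/
theorem HasWeakDeriv.exists_isPrimitive {f g : L2 Ω} (h : HasWeakDeriv f g) (hcd : c < d)
    (hsub : Ioo c d ⊆ (Ω : Set ℝ)) :
    ∃ F : ℝ → ℂ, IsPrimitive F g c d ∧ ∀ᵐ x ∂(volume.restrict (Ioo c d)), f x = F x := by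
  let I : Opens ℝ := ⟨Ioo c d, isOpen_Ioo⟩
  have hG := IsPrimitive.integral hcd (intervalIntegrable_of_Ioo_subset g hcd.le hsub) 0
  set G : ℝ → ℂ := fun x => 0 + ∫ t in c..x, g t
  have hm : MemLp (fun x => f x - G x) 2 (volume.restrict (I : Set ℝ)) :=
    (memLp_Ioo f hsub).sub (ContinuousOn.memLp_Ioo hG.continuousOn)
  have hw : HasWeakDeriv (Ω := I) (hm.toLp _) 0 := by
    intro φ hφ
    have hφΩ : IsTestFunction Ω φ := ⟨hφ.1, hφ.2, hφ.3.trans hsub⟩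
    have hz (ψ : ℝ → ℝ) (hψ : IsTestFunction I ψ) (u : ℝ → ℂ) :
        ∫ x in (Ω : Set ℝ), ψ x • u x = ∫ x in Ioo c d, ψ x • u x := by
      refine setIntegral_eq_of_subset_of_forall_sdiff_eq_zero Ω.isOpen.measurableSet hsub ?_
      intro x hx
      rw [hψ.eq_zero hx.2, zero_smul]
    have h1 := h φ hφΩ
    rw [hz _ hφ.deriv, hz _ hφ] at h1
    have h2 := hG.integral_test hφ (c := c) (d := d) (fun h => lt_irrefl _ h.1)
      (fun h => lt_irrefl _ h.2)
    have e : ∫ x in (I : Set ℝ), φ x • (0 : L2 I) x = 0 := by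
      rw [integral_eq_zero_of_ae]
      filter_upwards [Lp.coeFn_zero ℂ 2 (volume.restrict (I : Set ℝ))] with x hx
      have hx' : (0 : L2 I) x = (0 : ℂ) := hx
      rw [hx', smul_zero, Pi.zero_apply]
    have i1 : Integrable (fun x => deriv φ x • f x) (volume.restrict (Ioo c d)) :=
      (hφΩ.deriv.integrable_smul f).mono_measure (Measure.restrict_mono hsub le_rfl)
    have i2 : Integrable (fun x => deriv φ x • G x) (volume.restrict (Ioo c d)) := by
      have : ContinuousOn (fun x => deriv φ x • G x) (Icc c d) :=
        hφ.deriv.1.continuous.continuousOn.smul hG.continuousOn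
      exact this.integrableOn_Icc.mono_set Ioo_subset_Icc_self
    rw [e, neg_zero]
    have e2 : ∫ x in (I : Set ℝ), deriv φ x • (hm.toLp _ : L2 I) x
        = ∫ x in Ioo c d, (deriv φ x • f x - deriv φ x • G x) := by
      refine integral_congr_ae ?_
      filter_upwards [hm.coeFn_toLp] with x hx
      rw [hx, smul_sub]
    rw [e2, integral_sub i1 i2, h1, h2, sub_self]
  obtain ⟨C, hC⟩ := hw.ae_const hcd subset_rfl
  refine ⟨fun x => C + ∫ t in c..x, g t,
    IsPrimitive.integral hcd (intervalIntegrable_of_Ioo_subset g hcd.le hsub) C, ?_⟩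
  filter_upwards [hC, show ∀ᵐ x ∂(volume.restrict (Ioo c d)), _ from hm.coeFn_toLp] with x h1 h2
  rw [h1] at h2
  simp only [G, zero_add] at h2
  rw [h2]
  ring

theorem eqOn_Icc_of_ae_eq {F G : ℝ → ℂ} (hcd : c < d) (hF : ContinuousOn F (Icc c d))
    (hG : ContinuousOn G (Icc c d)) (h : ∀ᵐ x ∂(volume.restrict (Ioo c d)), F x = G x) :
    EqOn F G (Icc c d) := by
  refine Measure.eqOn_Icc_of_ae_eq volume hcd.ne ?_ hF hG
  rw [← restrict_Ioo_eq_restrict_Icc]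
  exact h

theorem Icc_subset_closure {s : Set ℝ} (hcd : c < d) (hsub : Ioo c d ⊆ s) :
    Icc c d ⊆ closure s := by
  rw [← closure_Ioo hcd.ne]
  exact closure_mono hsub

/-- A trace is the value of any representative which is continuous up to the boundary. -/
theorem HasTrace.eq_of_ae_eq {f : L2 Ω} {F : ℝ → ℂ} {x : ℝ} {v : ℂ} (h : HasTrace f x v)
    (hcd : c < d) (hsub : Ioo c d ⊆ (Ω : Set ℝ)) (hx : x ∈ Icc c d)
    (hF : ContinuousOn F (Icc c d)) (hfF : ∀ᵐ y ∂(volume.restrict (Ioo c d)), f y = F y) :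
    F x = v := by
  obtain ⟨G, hG, hfG, rfl⟩ := h
  refine eqOn_Icc_of_ae_eq hcd hF (hG.mono (Icc_subset_closure hcd hsub)) ?_ hx
  filter_upwards [hfF, ae_restrict_of_ae_restrict_of_subset hsub hfG] with y h1 h2
  rw [← h1, h2]

end Sobolev

section Bar

variable {p : BarParameters}

theorem BarParameters.Ioo_subset_inner (p : BarParameters) :
    Ioo p.L₁ p.L₂ ⊆ (p.inner : Set ℝ) := subset_rfl

theorem BarParameters.Ioo_subset_outer_left (p : BarParameters) :
    Ioo 0 p.L₁ ⊆ (p.outer : Set ℝ) := subset_union_left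

theorem BarParameters.Ioo_subset_outer_right (p : BarParameters) :
    Ioo p.L₂ p.L₃ ⊆ (p.outer : Set ℝ) := subset_union_right

theorem BarParameters.disjoint_outer (p : BarParameters) :
    Disjoint (Ioo 0 p.L₁) (Ioo p.L₂ p.L₃) := by
  rw [Set.disjoint_left]
  intro x h1 h2
  exact absurd (h1.2.trans p.L₁_lt_L₂) (not_lt.2 h2.1.le)

theorem ae_outer_iff {P : ℝ → Prop} : (∀ᵐ x ∂(volume.restrict (p.outer : Set ℝ)), P x) ↔
    (∀ᵐ x ∂(volume.restrict (Ioo 0 p.L₁)), P x) ∧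
      ∀ᵐ x ∂(volume.restrict (Ioo p.L₂ p.L₃)), P x :=
  ae_restrict_union_iff _ _ _

theorem integral_outer {h : ℝ → ℂ} (hh : Integrable h (volume.restrict (p.outer : Set ℝ))) :
    ∫ x in (p.outer : Set ℝ), h x = (∫ x in Ioo 0 p.L₁, h x) + ∫ x in Ioo p.L₂ p.L₃, h x :=
  setIntegral_union p.disjoint_outer measurableSet_Ioo
    (IntegrableOn.mono_set hh p.Ioo_subset_outer_left)
    (IntegrableOn.mono_set hh p.Ioo_subset_outer_right)

theorem hasWeakDeriv_inner {f g : L2 p.inner} {F : ℝ → ℂ} (hF : IsPrimitive F g p.L₁ p.L₂)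
    (hf : ∀ᵐ x ∂(volume.restrict (Ioo p.L₁ p.L₂)), f x = F x) : HasWeakDeriv f g := by
  intro φ hφ
  have h := hF.integral_test hφ (fun h => lt_irrefl _ h.1) (fun h => lt_irrefl _ h.2)
  refine Eq.trans (integral_congr_ae ?_) h
  filter_upwards [show ∀ᵐ x ∂(volume.restrict (p.inner : Set ℝ)), _ from hf] with x hx
  rw [hx]

theorem hasWeakDeriv_outer {f g : L2 p.outer} {F G : ℝ → ℂ} (hF : IsPrimitive F g 0 p.L₁)
    (hG : IsPrimitive G g p.L₂ p.L₃)
    (hf : ∀ᵐ x ∂(volume.restrict (Ioo 0 p.L₁)), f x = F x)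
    (hg : ∀ᵐ x ∂(volume.restrict (Ioo p.L₂ p.L₃)), f x = G x) : HasWeakDeriv f g := by
  have h12 := p.L₁_lt_L₂
  have h23 := p.L₂_lt_L₃
  have h1 := p.L₁_pos
  intro φ hφ
  have k1 := hF.integral_test hφ (by rintro (h | h) <;> linarith [h.1, h.2])
    (by rintro (h | h) <;> linarith [h.1, h.2])
  have k2 := hG.integral_test hφ (by rintro (h | h) <;> linarith [h.1, h.2])
    (by rintro (h | h) <;> linarith [h.1, h.2])
  rw [integral_outer (hφ.deriv.integrable_smul f), integral_outer (hφ.integrable_smul g), neg_add,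
    ← k1, ← k2]
  congr 1
  · refine integral_congr_ae ?_
    filter_upwards [hf] with x hx
    rw [hx]
  · refine integral_congr_ae ?_
    filter_upwards [hg] with x hx
    rw [hx]

theorem hasTrace_inner {f : L2 p.inner} {F : ℝ → ℂ} (hF : ContinuousOn F (Icc p.L₁ p.L₂))
    (hf : ∀ᵐ x ∂(volume.restrict (Ioo p.L₁ p.L₂)), f x = F x) (x : ℝ) : HasTrace f x (F x) := by
  refine ⟨F, ?_, hf, rfl⟩
  rwa [show (p.inner : Set ℝ) = Ioo p.L₁ p.L₂ from rfl, closure_Ioo p.L₁_lt_L₂.ne]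

/-- The function on the outer part which is `F` on `[0, L₁]` and `G` on `[L₂, L₃]`. -/
noncomputable def glue (p : BarParameters) (F G : ℝ → ℂ) (x : ℝ) : ℂ :=
  if x ≤ p.L₁ then F x else G x

theorem glue_left {F G : ℝ → ℂ} {x : ℝ} (hx : x ≤ p.L₁) : glue p F G x = F x := if_pos hx

theorem glue_right {F G : ℝ → ℂ} {x : ℝ} (hx : p.L₂ ≤ x) : glue p F G x = G x :=
  if_neg (not_le.2 (p.L₁_lt_L₂.trans_le hx))

theorem continuousOn_glue {F G : ℝ → ℂ} (hF : ContinuousOn F (Icc 0 p.L₁))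
    (hG : ContinuousOn G (Icc p.L₂ p.L₃)) :
    ContinuousOn (glue p F G) (closure (p.outer : Set ℝ)) := by
  have : closure (p.outer : Set ℝ) = Icc 0 p.L₁ ∪ Icc p.L₂ p.L₃ := by
    rw [show (p.outer : Set ℝ) = Ioo 0 p.L₁ ∪ Ioo p.L₂ p.L₃ from rfl, closure_union,
      closure_Ioo p.L₁_pos.ne, closure_Ioo p.L₂_lt_L₃.ne]
  rw [this]
  exact (hF.congr fun x hx => glue_left hx.2).union_of_isClosed
    (hG.congr fun x hx => glue_right hx.1) isClosed_Icc isClosed_Icc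

theorem ae_glue {f : L2 p.outer} {F G : ℝ → ℂ}
    (hf : ∀ᵐ x ∂(volume.restrict (Ioo 0 p.L₁)), f x = F x)
    (hg : ∀ᵐ x ∂(volume.restrict (Ioo p.L₂ p.L₃)), f x = G x) :
    ∀ᵐ x ∂(volume.restrict (p.outer : Set ℝ)), f x = glue p F G x := by
  rw [ae_outer_iff]
  constructor
  · filter_upwards [hf, ae_restrict_mem measurableSet_Ioo] with x h1 h2
    rw [h1, glue_left h2.2.le]
  · filter_upwards [hg, ae_restrict_mem measurableSet_Ioo] with x h1 h2
    rw [h1, glue_right h2.1.le]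

theorem hasTrace_outer {f : L2 p.outer} {F G : ℝ → ℂ} (hF : ContinuousOn F (Icc 0 p.L₁))
    (hG : ContinuousOn G (Icc p.L₂ p.L₃))
    (hf : ∀ᵐ x ∂(volume.restrict (Ioo 0 p.L₁)), f x = F x)
    (hg : ∀ᵐ x ∂(volume.restrict (Ioo p.L₂ p.L₃)), f x = G x) (x : ℝ) :
    HasTrace f x (glue p F G x) :=
  ⟨glue p F G, continuousOn_glue hF hG, ae_glue hf hg, rfl⟩

theorem exists_L2_inner {F : ℝ → ℂ} (hF : ContinuousOn F (Icc p.L₁ p.L₂)) :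
    ∃ f : L2 p.inner, ∀ᵐ x ∂(volume.restrict (Ioo p.L₁ p.L₂)), f x = F x :=
  ⟨MemLp.toLp F (ContinuousOn.memLp_Ioo hF),
    MemLp.coeFn_toLp (μ := volume.restrict (Ioo p.L₁ p.L₂)) (ContinuousOn.memLp_Ioo hF)⟩

theorem exists_L2_outer {F G : ℝ → ℂ} (hF : ContinuousOn F (Icc 0 p.L₁))
    (hG : ContinuousOn G (Icc p.L₂ p.L₃)) :
    ∃ f : L2 p.outer, (∀ᵐ x ∂(volume.restrict (Ioo 0 p.L₁)), f x = F x) ∧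
      ∀ᵐ x ∂(volume.restrict (Ioo p.L₂ p.L₃)), f x = G x := by
  have hm : MemLp ((Ioo 0 p.L₁).indicator F + (Ioo p.L₂ p.L₃).indicator G) 2
      (volume.restrict (p.outer : Set ℝ)) := by
    refine MemLp.add ?_ ?_
    · rw [memLp_indicator_iff_restrict measurableSet_Ioo,
        Measure.restrict_restrict measurableSet_Ioo,
        inter_eq_left.2 p.Ioo_subset_outer_left]
      exact ContinuousOn.memLp_Ioo hF
    · rw [memLp_indicator_iff_restrict measurableSet_Ioo,
        Measure.restrict_restrict measurableSet_Ioo,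
        inter_eq_left.2 p.Ioo_subset_outer_right]
      exact ContinuousOn.memLp_Ioo hG
  obtain ⟨h1, h2⟩ := ae_outer_iff.1 hm.coeFn_toLp
  refine ⟨hm.toLp _, ?_, ?_⟩
  · filter_upwards [h1, ae_restrict_mem measurableSet_Ioo] with x h1 h2
    rw [h1, Pi.add_apply, indicator_of_mem h2,
      indicator_of_notMem (Set.disjoint_left.1 p.disjoint_outer h2), add_zero]
  · filter_upwards [h2, ae_restrict_mem measurableSet_Ioo] with x h1 h2
    rw [h1, Pi.add_apply, indicator_of_mem h2,
      indicator_of_notMem (Set.disjoint_right.1 p.disjoint_outer h2), zero_add]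

end Bar

variable {p : BarParameters}

instance : IsFiniteMeasure (volume.restrict (p.inner : Set ℝ)) :=
  inferInstanceAs (IsFiniteMeasure (volume.restrict (Ioo p.L₁ p.L₂)))

instance : IsFiniteMeasure (volume.restrict (p.outer : Set ℝ)) :=
  ⟨by
    rw [Measure.restrict_apply_univ]
    exact measure_union_lt_top measure_Ioo_lt_top measure_Ioo_lt_top⟩

/-! ### Profiles: continuous functions on `[0, L₃]` cut at the interfaces -/

/-- The pair `(u, v)` has weak derivative `(u', v')` and consists of the restrictions of a function
which is absolutely continuous on `[0, L₃]` and vanishes at `0` and `L₃`. Its restrictions to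
`[L₁, L₂]`, `[0, L₁]` and `[L₂, L₃]` are `F₀`, `F₁` and `F₂`. -/
structure IsProfile (u u' : L2 p.inner) (v v' : L2 p.outer) (F₀ F₁ F₂ : ℝ → ℂ) : Prop where
  prim₀ : IsPrimitive F₀ u' p.L₁ p.L₂
  prim₁ : IsPrimitive F₁ v' 0 p.L₁
  prim₂ : IsPrimitive F₂ v' p.L₂ p.L₃
  ae₀ : ∀ᵐ x ∂(volume.restrict (Ioo p.L₁ p.L₂)), u x = F₀ x
  ae₁ : ∀ᵐ x ∂(volume.restrict (Ioo 0 p.L₁)), v x = F₁ x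
  ae₂ : ∀ᵐ x ∂(volume.restrict (Ioo p.L₂ p.L₃)), v x = F₂ x
  left : F₁ 0 = 0
  right : F₂ p.L₃ = 0
  interface₁ : F₀ p.L₁ = F₁ p.L₁
  interface₂ : F₀ p.L₂ = F₂ p.L₂

namespace IsProfile

variable {u u' : L2 p.inner} {v v' : L2 p.outer} {F₀ F₁ F₂ : ℝ → ℂ}

theorem hasWeakDeriv_left (h : IsProfile u u' v v' F₀ F₁ F₂) : HasWeakDeriv u u' :=
  hasWeakDeriv_inner h.prim₀ h.ae₀

theorem hasWeakDeriv_right (h : IsProfile u u' v v' F₀ F₁ F₂) : HasWeakDeriv v v' :=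
  hasWeakDeriv_outer h.prim₁ h.prim₂ h.ae₁ h.ae₂

theorem matching (h : IsProfile u u' v v' F₀ F₁ F₂) : Matching p u v := by
  have tu := hasTrace_inner h.prim₀.continuousOn h.ae₀
  have tv := hasTrace_outer h.prim₁.continuousOn h.prim₂.continuousOn h.ae₁ h.ae₂
  refine ⟨?_, ?_, ⟨F₀ p.L₁, tu _, ?_⟩, ⟨F₀ p.L₂, tu _, ?_⟩⟩
  · simpa only [glue_left p.L₁_pos.le, h.left] using tv 0
  · simpa only [glue_right p.L₂_lt_L₃.le, h.right] using tv p.L₃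
  · simpa only [glue_left le_rfl, h.interface₁] using tv p.L₁
  · simpa only [glue_right le_rfl, h.interface₂] using tv p.L₂

/-- The derivative of a function vanishing at `0` and `L₃` has mean value zero. -/
theorem integral_eq_zero (h : IsProfile u u' v v' F₀ F₁ F₂) :
    (∫ x in (p.inner : Set ℝ), u' x) + ∫ x in (p.outer : Set ℝ), v' x = 0 := by
  have e₀ := h.prim₀.eq p.L₂ ⟨p.L₁_lt_L₂.le, le_rfl⟩
  have e₁ := h.prim₁.eq p.L₁ ⟨p.L₁_pos.le, le_rfl⟩
  have e₂ := h.prim₂.eq p.L₃ ⟨p.L₂_lt_L₃.le, le_rfl⟩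
  rw [intervalIntegral.integral_of_le p.L₁_lt_L₂.le, integral_Ioc_eq_integral_Ioo] at e₀
  rw [intervalIntegral.integral_of_le p.L₁_pos.le, integral_Ioc_eq_integral_Ioo] at e₁
  rw [intervalIntegral.integral_of_le p.L₂_lt_L₃.le, integral_Ioc_eq_integral_Ioo] at e₂
  rw [integral_outer (((Lp.memLp v').integrable one_le_two))]
  change (∫ x in Ioo p.L₁ p.L₂, u' x) + _ = 0
  rw [h.left, zero_add] at e₁
  rw [h.right, ← h.interface₂, e₀, h.interface₁, e₁] at e₂
  rw [e₂]
  ring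

/-- The states with prescribed velocity, temperature and flux whose displacement is a given
profile. -/
theorem exists_state (h : IsProfile u u' v v' F₀ F₁ F₂) (θ q w : L2 p.inner) (z : L2 p.outer) :
    ∃ U : StateSpace p, (U.u₁ : L2 p.inner) = u ∧ (U.v₁ : L2 p.outer) = v ∧
      weakDeriv _ U.u₁ = u' ∧ weakDeriv _ U.v₁ = v' ∧ U.θ = θ ∧ U.q = q ∧ U.u₂ = w ∧ U.v₂ = z :=
  ⟨StateSpace.mk ⟨u, h.hasWeakDeriv_left.mem_H1⟩ ⟨v, h.hasWeakDeriv_right.mem_H1⟩ θ q w z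
    h.matching, rfl, rfl, weakDeriv_eq h.hasWeakDeriv_left, weakDeriv_eq h.hasWeakDeriv_right,
    rfl, rfl, rfl, rfl⟩

end IsProfile

theorem Matching.exists_isProfile {u u' : L2 p.inner} {v v' : L2 p.outer} (h : Matching p u v)
    (hu : HasWeakDeriv u u') (hv : HasWeakDeriv v v') :
    ∃ F₀ F₁ F₂ : ℝ → ℂ, IsProfile u u' v v' F₀ F₁ F₂ := by
  obtain ⟨F₀, h₀, a₀⟩ := hu.exists_isPrimitive p.L₁_lt_L₂ p.Ioo_subset_inner
  obtain ⟨F₁, h₁, a₁⟩ := hv.exists_isPrimitive p.L₁_pos p.Ioo_subset_outer_left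
  obtain ⟨F₂, h₂, a₂⟩ := hv.exists_isPrimitive p.L₂_lt_L₃ p.Ioo_subset_outer_right
  obtain ⟨c, hc, hc'⟩ := h.interface₁
  obtain ⟨d, hd, hd'⟩ := h.interface₂
  refine ⟨F₀, F₁, F₂, h₀, h₁, h₂, a₀, a₁, a₂, ?_, ?_, ?_, ?_⟩
  · exact h.left.eq_of_ae_eq p.L₁_pos p.Ioo_subset_outer_left ⟨le_rfl, p.L₁_pos.le⟩
      h₁.continuousOn a₁
  · exact h.right.eq_of_ae_eq p.L₂_lt_L₃ p.Ioo_subset_outer_right ⟨p.L₂_lt_L₃.le, le_rfl⟩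
      h₂.continuousOn a₂
  · rw [hc.eq_of_ae_eq p.L₁_lt_L₂ p.Ioo_subset_inner ⟨le_rfl, p.L₁_lt_L₂.le⟩ h₀.continuousOn a₀,
      hc'.eq_of_ae_eq p.L₁_pos p.Ioo_subset_outer_left ⟨p.L₁_pos.le, le_rfl⟩ h₁.continuousOn a₁]
  · rw [hd.eq_of_ae_eq p.L₁_lt_L₂ p.Ioo_subset_inner ⟨p.L₁_lt_L₂.le, le_rfl⟩ h₀.continuousOn a₀,
      hd'.eq_of_ae_eq p.L₂_lt_L₃ p.Ioo_subset_outer_right ⟨le_rfl, p.L₂_lt_L₃.le⟩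
        h₂.continuousOn a₂]

theorem exists_isProfile_of_integral_eq_zero (u' : L2 p.inner) (v' : L2 p.outer)
    (h : (∫ x in (p.inner : Set ℝ), u' x) + ∫ x in (p.outer : Set ℝ), v' x = 0) :
    ∃ (u : L2 p.inner) (v : L2 p.outer) (F₀ F₁ F₂ : ℝ → ℂ), IsProfile u u' v v' F₀ F₁ F₂ := by
  have i₀ := intervalIntegrable_of_Ioo_subset u' p.L₁_lt_L₂.le p.Ioo_subset_inner
  have i₁ := intervalIntegrable_of_Ioo_subset v' p.L₁_pos.le p.Ioo_subset_outer_left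
  have i₂ := intervalIntegrable_of_Ioo_subset v' p.L₂_lt_L₃.le p.Ioo_subset_outer_right
  set A : ℂ := ∫ t in (0 : ℝ)..p.L₁, v' t with hA
  set B : ℂ := ∫ t in p.L₁..p.L₂, u' t with hB
  have h₁ := IsPrimitive.integral p.L₁_pos i₁ 0
  have h₀ := IsPrimitive.integral p.L₁_lt_L₂ i₀ A
  have h₂ := IsPrimitive.integral p.L₂_lt_L₃ i₂ (A + B)
  obtain ⟨u, hu⟩ := exists_L2_inner h₀.continuousOn
  obtain ⟨v, hv₁, hv₂⟩ := exists_L2_outer h₁.continuousOn h₂.continuousOn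
  refine ⟨u, v, _, _, _, h₀, h₁, h₂, hu, hv₁, hv₂, by simp, ?_, by simp [hA], by simp [hB]⟩
  rw [integral_outer (((Lp.memLp v').integrable one_le_two))] at h
  rw [hA, hB, intervalIntegral.integral_of_le p.L₁_lt_L₂.le,
    intervalIntegral.integral_of_le p.L₁_pos.le, intervalIntegral.integral_of_le p.L₂_lt_L₃.le,
    integral_Ioc_eq_integral_Ioo, integral_Ioc_eq_integral_Ioo, integral_Ioc_eq_integral_Ioo, ← h]
  change _ = (∫ x in Ioo p.L₁ p.L₂, u' x) + _
  ring

/-! ### Completeness of the state space -/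

theorem tendsto_integral {Ω : Opens ℝ} [IsFiniteMeasure (volume.restrict (Ω : Set ℝ))]
    {f : ℕ → L2 Ω} (g : L2 Ω) (h : Filter.Tendsto f Filter.atTop (nhds g)) :
    Filter.Tendsto (fun n => ∫ x in (Ω : Set ℝ), f n x) Filter.atTop
      (nhds (∫ x in (Ω : Set ℝ), g x)) := by
  have key (f : L2 Ω) : inner ℂ (indicatorConstLp 2 MeasurableSet.univ
      (measure_ne_top (volume.restrict (Ω : Set ℝ)) univ) (1 : ℂ)) f
      = ∫ x in (Ω : Set ℝ), f x := by
    rw [L2.inner_indicatorConstLp_one, Measure.restrict_univ]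
  simp only [← key]
  exact Filter.Tendsto.inner tendsto_const_nhds h

namespace StateSpace

theorem norm_sq_eq (U : StateSpace p) : ‖U‖ ^ 2 =
    p.a * ‖weakDeriv _ U.u₁‖ ^ 2 + ‖U.u₂‖ ^ 2 + ‖U.θ‖ ^ 2 + p.τ * ‖U.q‖ ^ 2
      + p.b * ‖weakDeriv _ U.v₁‖ ^ 2 + ‖U.v₂‖ ^ 2 := by
  rw [← re_energyInner_self]
  exact (inner_self_eq_norm_sq (𝕜 := ℂ) U).symm

theorem exists_isProfile (U : StateSpace p) : ∃ F₀ F₁ F₂ : ℝ → ℂ,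
    IsProfile (U.u₁ : L2 p.inner) (weakDeriv _ U.u₁) (U.v₁ : L2 p.outer) (weakDeriv _ U.v₁)
      F₀ F₁ F₂ :=
  U.matching.exists_isProfile (hasWeakDeriv_weakDeriv _) (hasWeakDeriv_weakDeriv _)

/-- The component `u¹ₓ`. -/
noncomputable def strain₁ (p : BarParameters) : StateSpace p →ₗ[ℂ] L2 p.inner where
  toFun U := weakDeriv _ U.u₁
  map_add' := weakDeriv_u₁_add
  map_smul' := weakDeriv_u₁_smul

/-- The component `v¹ₓ`. -/
noncomputable def strain₂ (p : BarParameters) : StateSpace p →ₗ[ℂ] L2 p.outer where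
  toFun U := weakDeriv _ U.v₁
  map_add' := weakDeriv_v₁_add
  map_smul' := weakDeriv_v₁_smul

/-- A component of the state which is controlled by the energy depends continuously on it. -/
theorem cauchySeq_of_le {E : Type*} [NormedAddCommGroup E] [Module ℂ E]
    (T : StateSpace p →ₗ[ℂ] E) {c : ℝ} (hc : 0 < c) (hT : ∀ U, c * ‖T U‖ ^ 2 ≤ ‖U‖ ^ 2)
    {U : ℕ → StateSpace p} (hU : CauchySeq U) : CauchySeq fun n => T (U n) := by
  have hb : ∀ V, ‖T V‖ ≤ (√c)⁻¹ * ‖V‖ := by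
    intro V
    have h1 : √c * ‖T V‖ ≤ ‖V‖ := by
      refine le_of_sq_le_sq ?_ (norm_nonneg _)
      rw [mul_pow, Real.sq_sqrt hc.le]
      exact hT V
    rw [inv_mul_eq_div, le_div_iff₀ (Real.sqrt_pos.2 hc)]
    linarith
  rw [Metric.cauchySeq_iff] at hU ⊢
  intro ε hε
  obtain ⟨N, hN⟩ := hU (√c * ε) (mul_pos (Real.sqrt_pos.2 hc) hε)
  refine ⟨N, fun m hm n hn => ?_⟩
  have := hN m hm n hn
  rw [dist_eq_norm] at this ⊢
  rw [← map_sub]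
  refine (hb _).trans_lt ?_
  rw [inv_mul_eq_div, div_lt_iff₀ (Real.sqrt_pos.2 hc)]
  linarith

/-- The map `U ↦ (u¹ₓ, v¹ₓ, θ, q, u², v²)` identifies the state space with the closed subspace of
the `L²` tuples for which `u¹ₓ` and `v¹ₓ` have total integral zero. -/
instance instCompleteSpace : CompleteSpace (StateSpace p) := by
  refine Metric.complete_of_cauchySeq_tendsto fun U hU => ?_
  have ha := p.a_pos
  have ht := p.τ_pos
  have hb := p.b_pos
  have hn (V : StateSpace p) := norm_sq_eq V
  have i1 (V : StateSpace p) : 0 ≤ p.a * ‖weakDeriv _ V.u₁‖ ^ 2 := by positivity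
  have i2 (V : StateSpace p) : 0 ≤ ‖V.u₂‖ ^ 2 := by positivity
  have i3 (V : StateSpace p) : 0 ≤ ‖V.θ‖ ^ 2 := by positivity
  have i4 (V : StateSpace p) : 0 ≤ p.τ * ‖V.q‖ ^ 2 := by positivity
  have i5 (V : StateSpace p) : 0 ≤ p.b * ‖weakDeriv _ V.v₁‖ ^ 2 := by positivity
  have i6 (V : StateSpace p) : 0 ≤ ‖V.v₂‖ ^ 2 := by positivity
  obtain ⟨α, hα⟩ := cauchySeq_tendsto_of_complete <| cauchySeq_of_le
    (strain₁ p) ha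
    (fun V => by
      change p.a * ‖weakDeriv _ V.u₁‖ ^ 2 ≤ _
      linarith [hn V, i1 V, i2 V, i3 V, i4 V, i5 V, i6 V]) hU
  obtain ⟨β, hβ⟩ := cauchySeq_tendsto_of_complete <| cauchySeq_of_le
    (strain₂ p) hb
    (fun V => by
      change p.b * ‖weakDeriv _ V.v₁‖ ^ 2 ≤ _
      linarith [hn V, i1 V, i2 V, i3 V, i4 V, i5 V, i6 V]) hU
  obtain ⟨θ', hθ⟩ := cauchySeq_tendsto_of_complete <| cauchySeq_of_le
    (⟨⟨θ, θ_add⟩, θ_smul⟩ : StateSpace p →ₗ[ℂ] L2 p.inner) one_pos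
    (fun V => by
      change 1 * ‖V.θ‖ ^ 2 ≤ _
      linarith [hn V, i1 V, i2 V, i3 V, i4 V, i5 V, i6 V]) hU
  obtain ⟨q', hq⟩ := cauchySeq_tendsto_of_complete <| cauchySeq_of_le
    (⟨⟨q, q_add⟩, q_smul⟩ : StateSpace p →ₗ[ℂ] L2 p.inner) ht
    (fun V => by
      change p.τ * ‖V.q‖ ^ 2 ≤ _
      linarith [hn V, i1 V, i2 V, i3 V, i4 V, i5 V, i6 V]) hU
  obtain ⟨w, hw⟩ := cauchySeq_tendsto_of_complete <| cauchySeq_of_le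
    (⟨⟨u₂, u₂_add⟩, u₂_smul⟩ : StateSpace p →ₗ[ℂ] L2 p.inner) one_pos
    (fun V => by
      change 1 * ‖V.u₂‖ ^ 2 ≤ _
      linarith [hn V, i1 V, i2 V, i3 V, i4 V, i5 V, i6 V]) hU
  obtain ⟨z, hz⟩ := cauchySeq_tendsto_of_complete <| cauchySeq_of_le
    (⟨⟨v₂, v₂_add⟩, v₂_smul⟩ : StateSpace p →ₗ[ℂ] L2 p.outer) one_pos
    (fun V => by
      change 1 * ‖V.v₂‖ ^ 2 ≤ _
      linarith [hn V, i1 V, i2 V, i3 V, i4 V, i5 V, i6 V]) hU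
  have hmean : (∫ x in (p.inner : Set ℝ), α x) + ∫ x in (p.outer : Set ℝ), β x = 0 := by
    have l1 := tendsto_integral α hα
    have l2 := tendsto_integral β hβ
    refine tendsto_nhds_unique (l1.add l2) (tendsto_const_nhds.congr fun n => ?_)
    obtain ⟨F₀, F₁, F₂, h⟩ := (U n).exists_isProfile
    exact h.integral_eq_zero.symm
  obtain ⟨u, v, F₀, F₁, F₂, h⟩ := exists_isProfile_of_integral_eq_zero α β hmean
  obtain ⟨V, -, -, h1, h2, h3, h4, h5, h6⟩ := h.exists_state θ' q' w z
  refine ⟨V, ?_⟩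
  rw [tendsto_iff_norm_sub_tendsto_zero] at hα hβ hθ hq hw hz ⊢
  have lim := ((((((hα.pow 2).const_mul p.a).add (hw.pow 2)).add (hθ.pow 2)).add
    ((hq.pow 2).const_mul p.τ)).add ((hβ.pow 2).const_mul p.b)).add (hz.pow 2)
  have hs : Filter.Tendsto (fun n => ‖U n - V‖ ^ 2) Filter.atTop (nhds 0) := by
    refine Filter.Tendsto.congr (fun n => ?_) (by simpa using lim)
    have e1 : weakDeriv _ (U n - V).u₁ = strain₁ p (U n) - α := by
      rw [← h1]
      exact (strain₁ p).map_sub _ _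
    have e2 : weakDeriv _ (U n - V).v₁ = strain₂ p (U n) - β := by
      rw [← h2]
      exact (strain₂ p).map_sub _ _
    rw [hn, e1, e2, ← h3, ← h4, ← h5, ← h6]
    rfl
  simpa using hs.sqrt

end StateSpace

/-! ### The components of the generator -/

section Components

variable (U : generatorDomain p)

theorem generator_u₁ : (generator p U).u₁ = generatorDomain.u₂ p U := rfl

theorem generator_v₁ : (generator p U).v₁ = generatorDomain.v₂ p U := rfl

theorem generator_θ : (generator p U).θ = -((p.k : ℂ) • weakDeriv _ (generatorDomain.q p U)
    + (p.m : ℂ) • weakDeriv _ (generatorDomain.u₂ p U)) := by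
  change -(weakDeriv p.inner ((p.k : ℂ) • generatorDomain.q p U
    + (p.m : ℂ) • generatorDomain.u₂ p U)) = _
  rw [map_add, map_smul, map_smul]

theorem generator_q : (generator p U).q = -((p.k / p.τ : ℂ) • weakDeriv _ (generatorDomain.θ p U))
    - (1 / p.τ : ℂ) • U.1.q := rfl

theorem generator_u₂ : (generator p U).u₂ = (p.a : ℂ) • weakDeriv _ (generatorDomain.du₁ p U)
    - (p.m : ℂ) • weakDeriv _ (generatorDomain.θ p U) := by
  change weakDeriv p.inner ((p.a : ℂ) • generatorDomain.du₁ p U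
    - (p.m : ℂ) • generatorDomain.θ p U) = _
  rw [map_sub, map_smul, map_smul]

theorem generator_v₂ : (generator p U).v₂ = (p.b : ℂ) • weakDeriv _ (generatorDomain.dv₁ p U) :=
  rfl

end Components

/-! ### The kernel -/

theorem const_eq_of_ae {f : ℝ → ℂ} {c d : ℝ} (hcd : c < d) {r s : ℂ}
    (hr : ∀ᵐ x ∂(volume.restrict (Ioo c d)), f x = r)
    (hs : ∀ᵐ x ∂(volume.restrict (Ioo c d)), f x = s) : r = s :=
  eqOn_Icc_of_ae_eq (F := fun _ => r) (G := fun _ => s) hcd continuousOn_const continuousOn_const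
    (by filter_upwards [hr, hs] with x h1 h2; rw [← h1, h2]) (left_mem_Icc.2 hcd.le)

/-- The mean value condition for a profile with slope `r` on `(L₁, L₂)` and slope `s` on the outer
part. -/
theorem IsProfile.sum_slopes {u u' : L2 p.inner} {v v' : L2 p.outer} {F₀ F₁ F₂ : ℝ → ℂ}
    (h : IsProfile u u' v v' F₀ F₁ F₂) {r s : ℂ}
    (hr : ∀ᵐ x ∂(volume.restrict (Ioo p.L₁ p.L₂)), u' x = r)
    (hs₁ : ∀ᵐ x ∂(volume.restrict (Ioo 0 p.L₁)), v' x = s)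
    (hs₂ : ∀ᵐ x ∂(volume.restrict (Ioo p.L₂ p.L₃)), v' x = s) :
    (p.L₂ - p.L₁) * r + (p.L₁ + p.L₃ - p.L₂) * s = 0 := by
  have e := h.integral_eq_zero
  have h1 : ∫ x in Ioo p.L₁ p.L₂, u' x = (p.L₂ - p.L₁) * r := by
    rw [integral_congr_ae hr]
    simp [p.L₁_lt_L₂.le]
  have h2 : ∫ x in Ioo 0 p.L₁, v' x = p.L₁ * s := by
    rw [integral_congr_ae hs₁]
    simp [p.L₁_pos.le]
  have h3 : ∫ x in Ioo p.L₂ p.L₃, v' x = (p.L₃ - p.L₂) * s := by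
    rw [integral_congr_ae hs₂]
    simp [p.L₂_lt_L₃.le]
  rw [integral_outer ((Lp.memLp v').integrable one_le_two), h2, h3] at e
  change (∫ x in Ioo p.L₁ p.L₂, u' x) + _ = 0 at e
  rw [h1] at e
  linear_combination e

/-- The slope of `ζ¹`. -/
noncomputable def slope₁ (p : BarParameters) : ℂ := (p.L₂ - p.L₁ - p.L₃) / (p.L₁ * p.L₃)

/-- The slope of `ζ²`. -/
noncomputable def slope₂ (p : BarParameters) : ℂ := (p.L₂ - p.L₁) / (p.L₁ * p.L₃)

theorem exists_L2_const_inner (p : BarParameters) (r : ℂ) :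
    ∃ f : L2 p.inner, ∀ᵐ x ∂(volume.restrict (Ioo p.L₁ p.L₂)), f x = r :=
  exists_L2_inner (F := fun _ => r) continuousOn_const

theorem exists_zeta (p : BarParameters) : ∃ Z : StateSpace p, IsZeta p Z ∧
    (∀ᵐ x ∂(volume.restrict (Ioo p.L₁ p.L₂)), weakDeriv _ Z.u₁ x = slope₁ p) ∧
    (∀ᵐ x ∂(volume.restrict (Ioo 0 p.L₁)), weakDeriv _ Z.v₁ x = slope₂ p) ∧
    ∀ᵐ x ∂(volume.restrict (Ioo p.L₂ p.L₃)), weakDeriv _ Z.v₁ x = slope₂ p := by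
  have h1 : (p.L₁ : ℂ) ≠ 0 := Complex.ofReal_ne_zero.2 p.L₁_pos.ne'
  have h3 : (p.L₃ : ℂ) ≠ 0 := Complex.ofReal_ne_zero.2
    (p.L₁_pos.trans (p.L₁_lt_L₂.trans p.L₂_lt_L₃)).ne'
  obtain ⟨α, hα⟩ := exists_L2_const_inner p (slope₁ p)
  obtain ⟨θ, hθ⟩ := exists_L2_const_inner p (zeta₃ p)
  obtain ⟨β, hβ₁, hβ₂⟩ := exists_L2_outer (p := p) (F := fun _ => slope₂ p)
    (G := fun _ => slope₂ p) continuousOn_const continuousOn_const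
  have P₀ := (IsPrimitive.affine p.L₁_lt_L₂ (slope₁ p) 1).congr_ae (f := α)
    (hα.mono fun x hx => hx.symm)
  have P₁ := (IsPrimitive.affine p.L₁_pos (slope₂ p) 0).congr_ae (f := β)
    (hβ₁.mono fun x hx => hx.symm)
  have P₂ := (IsPrimitive.affine p.L₂_lt_L₃ (slope₂ p) (-((p.L₂ - p.L₁) / p.L₁))).congr_ae
    (f := β) (hβ₂.mono fun x hx => hx.symm)
  obtain ⟨u, hu⟩ := exists_L2_inner P₀.continuousOn
  obtain ⟨v, hv₁, hv₂⟩ := exists_L2_outer P₁.continuousOn P₂.continuousOn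
  have hP : IsProfile u α v β _ _ _ := ⟨P₀, P₁, P₂, hu, hv₁, hv₂, by simp,
    by simp only [slope₂]; field_simp; ring, by simp only [slope₁, slope₂]; field_simp; ring,
    by simp only [slope₁, slope₂]; field_simp; ring⟩
  obtain ⟨Z, z1, z2, z3, z4, z5, z6, z7, z8⟩ := hP.exists_state θ 0 0 0
  refine ⟨Z, ⟨?_, ?_, ?_, z6, z7, z8⟩, ?_, ?_, ?_⟩
  · rw [z1]
    filter_upwards [show ∀ᵐ x ∂(volume.restrict (p.inner : Set ℝ)), _ from hu] with x hx
    rw [hx, zeta₁, slope₁]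
    push_cast
    rfl
  · rw [z2, ae_outer_iff]
    constructor
    · filter_upwards [hv₁, ae_restrict_mem measurableSet_Ioo] with x hx hx'
      rw [hx, zeta₂, if_pos hx'.2.le, slope₂]
      push_cast
      ring
    · filter_upwards [hv₂, ae_restrict_mem measurableSet_Ioo] with x hx hx'
      rw [hx, zeta₂, if_neg (not_le.2 (p.L₁_lt_L₂.trans hx'.1)), slope₂]
      push_cast
      ring
  · rw [z5]
    exact hθ
  · rw [z3]
    exact hα
  · rw [z4]
    exact hβ₁
  · rw [z4]
    exact hβ₂

theorem hasWeakDeriv_zero_of_ae_const_inner {f : L2 p.inner} {r : ℂ}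
    (h : ∀ᵐ x ∂(volume.restrict (Ioo p.L₁ p.L₂)), f x = r) : HasWeakDeriv f 0 := by
  have hz := Lp.coeFn_zero ℂ 2 (volume.restrict (p.inner : Set ℝ))
  have hp := (IsPrimitive.affine p.L₁_lt_L₂ 0 r).congr_ae (f := (0 : L2 p.inner))
    (hz.mono fun x hx => hx.symm)
  refine hasWeakDeriv_inner hp ?_
  filter_upwards [h] with x hx
  rw [hx]
  ring

theorem hasWeakDeriv_zero_of_ae_const_outer {f : L2 p.outer} {r s : ℂ}
    (h₁ : ∀ᵐ x ∂(volume.restrict (Ioo 0 p.L₁)), f x = r)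
    (h₂ : ∀ᵐ x ∂(volume.restrict (Ioo p.L₂ p.L₃)), f x = s) : HasWeakDeriv f 0 := by
  obtain ⟨z1, z2⟩ := ae_outer_iff.1 (Lp.coeFn_zero ℂ 2 (volume.restrict (p.outer : Set ℝ)))
  have k1 := (IsPrimitive.affine p.L₁_pos 0 r).congr_ae (f := (0 : L2 p.outer))
    (z1.mono fun x hx => hx.symm)
  have k2 := (IsPrimitive.affine p.L₂_lt_L₃ 0 s).congr_ae (f := (0 : L2 p.outer))
    (z2.mono fun x hx => hx.symm)
  refine hasWeakDeriv_outer k1 k2 ?_ ?_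
  · filter_upwards [h₁] with x hx
    rw [hx]
    ring
  · filter_upwards [h₂] with x hx
    rw [hx]
    ring

/-- The stress balance `a ζ¹ₓ - m ζ³ = b ζ²ₓ`. -/
theorem slope_balance (p : BarParameters) :
    (p.a : ℂ) * slope₁ p - p.m * (zeta₃ p : ℝ) = p.b * slope₂ p := by
  have h1 : (p.L₁ : ℂ) ≠ 0 := Complex.ofReal_ne_zero.2 p.L₁_pos.ne'
  have h3 : (p.L₃ : ℂ) ≠ 0 := Complex.ofReal_ne_zero.2
    (p.L₁_pos.trans (p.L₁_lt_L₂.trans p.L₂_lt_L₃)).ne'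
  have hm : (p.m : ℂ) ≠ 0 := Complex.ofReal_ne_zero.2 p.m_pos.ne'
  rw [slope₁, slope₂, zeta₃]
  push_cast
  field_simp
  ring

theorem zeta_mem_kernel {Z : StateSpace p} (hZ : IsZeta p Z)
    (h₀ : ∀ᵐ x ∂(volume.restrict (Ioo p.L₁ p.L₂)), weakDeriv _ Z.u₁ x = slope₁ p)
    (h₁ : ∀ᵐ x ∂(volume.restrict (Ioo 0 p.L₁)), weakDeriv _ Z.v₁ x = slope₂ p)
    (h₂ : ∀ᵐ x ∂(volume.restrict (Ioo p.L₂ p.L₃)), weakDeriv _ Z.v₁ x = slope₂ p) :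
    ∃ h : Z ∈ (generator p).domain, generator p ⟨Z, h⟩ = 0 := by
  have d₀ := hasWeakDeriv_zero_of_ae_const_inner h₀
  have d₁ := hasWeakDeriv_zero_of_ae_const_outer h₁ h₂
  have dθ := hasWeakDeriv_zero_of_ae_const_inner (f := Z.θ) hZ.θ
  have hdom : InDomain p Z := by
    refine ⟨d₀.mem_H1, d₁.mem_H1, dθ.mem_H1, ?_, ?_, ?_, ?_, fun x _ => ?_, fun x hx => ?_⟩
    · rw [hZ.q]; exact zero_mem _
    · rw [hZ.u₂]; exact zero_mem _
    · rw [hZ.v₂]; exact zero_mem _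
    · rw [hZ.u₂, hZ.v₂]; exact Matching.zero
    · rw [hZ.q]; exact HasTrace.zero x
    · refine ⟨slope₁ p, (zeta₃ p : ℝ), slope₂ p, hasTrace_inner continuousOn_const h₀ x,
        hasTrace_inner (F := fun _ => ((zeta₃ p : ℝ) : ℂ)) continuousOn_const hZ.θ x, ?_,
        slope_balance p⟩
      have := hasTrace_outer (F := fun _ => slope₂ p) (G := fun _ => slope₂ p)
        continuousOn_const continuousOn_const h₁ h₂ x
      simpa [glue] using this
  refine ⟨hdom, ?_⟩
  set U : generatorDomain p := ⟨Z, hdom⟩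
  have eu : generatorDomain.u₂ p U = 0 := Subtype.ext hZ.u₂
  have ev : generatorDomain.v₂ p U = 0 := Subtype.ext hZ.v₂
  have eq : generatorDomain.q p U = 0 := Subtype.ext hZ.q
  have e1 : weakDeriv _ (generatorDomain.θ p U) = 0 := weakDeriv_eq dθ
  have e2 : weakDeriv _ (generatorDomain.du₁ p U) = 0 := weakDeriv_eq d₀
  have e3 : weakDeriv _ (generatorDomain.dv₁ p U) = 0 := weakDeriv_eq d₁
  have e4 : U.1.q = 0 := hZ.q
  refine StateSpace.ext ?_ ?_ ?_ ?_ ?_ ?_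
  · exact eu
  · exact ev
  · rw [show (⟨Z, hdom⟩ : (generator p).domain) = U from rfl, generator_θ, eu, eq]
    simp only [map_zero, smul_zero, add_zero, neg_zero]
    rfl
  · rw [show (⟨Z, hdom⟩ : (generator p).domain) = U from rfl, generator_q, e1, e4]
    simp only [smul_zero, neg_zero, sub_zero]
    rfl
  · rw [show (⟨Z, hdom⟩ : (generator p).domain) = U from rfl, generator_u₂, e1, e2]
    simp only [smul_zero, sub_zero]
    rfl
  · rw [show (⟨Z, hdom⟩ : (generator p).domain) = U from rfl, generator_v₂, e3]
    simp only [smul_zero]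
    rfl

theorem slope₂_ne_zero (p : BarParameters) : slope₂ p ≠ 0 := by
  have h12 := p.L₁_lt_L₂
  have h1 : (p.L₁ : ℂ) ≠ 0 := Complex.ofReal_ne_zero.2 p.L₁_pos.ne'
  have h3 : (p.L₃ : ℂ) ≠ 0 := Complex.ofReal_ne_zero.2
    (p.L₁_pos.trans (p.L₁_lt_L₂.trans p.L₂_lt_L₃)).ne'
  have h2 : (p.L₂ : ℂ) - p.L₁ ≠ 0 := by
    rw [← Complex.ofReal_sub]
    exact Complex.ofReal_ne_zero.2 (by linarith)
  exact div_ne_zero h2 (mul_ne_zero h1 h3)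

/-- A state in the kernel is determined by the slope of `v¹`, which is the same on both outer
intervals because the stress is constant on all of `[0, L₃]`. -/
theorem mem_span_of_generator_eq_zero {Z : StateSpace p} (hZ : IsZeta p Z)
    (h₀ : ∀ᵐ x ∂(volume.restrict (Ioo p.L₁ p.L₂)), weakDeriv _ Z.u₁ x = slope₁ p)
    (h₁ : ∀ᵐ x ∂(volume.restrict (Ioo 0 p.L₁)), weakDeriv _ Z.v₁ x = slope₂ p)
    (h₂ : ∀ᵐ x ∂(volume.restrict (Ioo p.L₂ p.L₃)), weakDeriv _ Z.v₁ x = slope₂ p)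
    (U : generatorDomain p) (hU : generator p U = 0) :
    (U : StateSpace p) ∈ Submodule.span ℂ {Z} := by
  have hk : (p.k : ℂ) ≠ 0 := Complex.ofReal_ne_zero.2 p.k_pos.ne'
  have hm : (p.m : ℂ) ≠ 0 := Complex.ofReal_ne_zero.2 p.m_pos.ne'
  have ha : (p.a : ℂ) ≠ 0 := Complex.ofReal_ne_zero.2 p.a_pos.ne'
  have hb : (p.b : ℂ) ≠ 0 := Complex.ofReal_ne_zero.2 p.b_pos.ne'
  have ht : (p.τ : ℂ) ≠ 0 := Complex.ofReal_ne_zero.2 p.τ_pos.ne'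
  have c1 : generatorDomain.u₂ p U = 0 := congrArg StateSpace.u₁ hU
  have c2 : generatorDomain.v₂ p U = 0 := congrArg StateSpace.v₁ hU
  have c3 : (generator p U).θ = 0 := congrArg StateSpace.θ hU
  have c4 : (generator p U).q = 0 := congrArg StateSpace.q hU
  have c5 : (generator p U).u₂ = 0 := congrArg StateSpace.u₂ hU
  have c6 : (generator p U).v₂ = 0 := congrArg StateSpace.v₂ hU
  rw [generator_θ, c1, map_zero, smul_zero, add_zero, neg_eq_zero, smul_eq_zero_iff_right hk] at c3
  -- the heat flux is constant and vanishes at the interfaces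
  have hq : U.1.q = 0 := by
    have hd : HasWeakDeriv U.1.q 0 := by
      have := hasWeakDeriv_weakDeriv (generatorDomain.q p U)
      rwa [c3] at this
    obtain ⟨C, hC⟩ := hd.ae_const p.L₁_lt_L₂ p.Ioo_subset_inner
    have := (U.2.q_trace p.L₁ (by simp)).eq_of_ae_const p.L₁_lt_L₂ p.Ioo_subset_inner
      ⟨le_rfl, p.L₁_lt_L₂.le⟩ hC
    rw [← this] at hC
    refine Lp.ext ?_
    filter_upwards [show ∀ᵐ x ∂(volume.restrict (p.inner : Set ℝ)), _ from hC,
      Lp.coeFn_zero ℂ 2 (volume.restrict (p.inner : Set ℝ))] with x hx h0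
    exact hx.trans h0.symm
  rw [generator_q, hq, smul_zero, sub_zero, neg_eq_zero,
    smul_eq_zero_iff_right (div_ne_zero hk ht)] at c4
  rw [generator_u₂, c4, smul_zero, sub_zero, smul_eq_zero_iff_right ha] at c5
  rw [generator_v₂, smul_eq_zero_iff_right hb] at c6
  have dθ : HasWeakDeriv U.1.θ 0 := by
    have := hasWeakDeriv_weakDeriv (generatorDomain.θ p U)
    rwa [c4] at this
  have du : HasWeakDeriv (weakDeriv _ U.1.u₁) 0 := by
    have := hasWeakDeriv_weakDeriv (generatorDomain.du₁ p U)
    rwa [c5] at this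
  have dv : HasWeakDeriv (weakDeriv _ U.1.v₁) 0 := by
    have := hasWeakDeriv_weakDeriv (generatorDomain.dv₁ p U)
    rwa [c6] at this
  obtain ⟨T, hT⟩ := dθ.ae_const p.L₁_lt_L₂ p.Ioo_subset_inner
  obtain ⟨A, hA⟩ := du.ae_const p.L₁_lt_L₂ p.Ioo_subset_inner
  obtain ⟨B, hB⟩ := dv.ae_const p.L₁_pos p.Ioo_subset_outer_left
  obtain ⟨B', hB'⟩ := dv.ae_const p.L₂_lt_L₃ p.Ioo_subset_outer_right
  have t1 : p.a * A - p.m * T = p.b * B := by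
    obtain ⟨r, s, t, hr, hs, ht, e⟩ := U.2.transmission p.L₁ (by simp)
    rwa [hr.eq_of_ae_const p.L₁_lt_L₂ p.Ioo_subset_inner ⟨le_rfl, p.L₁_lt_L₂.le⟩ hA,
      hs.eq_of_ae_const p.L₁_lt_L₂ p.Ioo_subset_inner ⟨le_rfl, p.L₁_lt_L₂.le⟩ hT,
      ht.eq_of_ae_const p.L₁_pos p.Ioo_subset_outer_left ⟨p.L₁_pos.le, le_rfl⟩ hB] at e
  have t2 : p.a * A - p.m * T = p.b * B' := by
    obtain ⟨r, s, t, hr, hs, ht, e⟩ := U.2.transmission p.L₂ (by simp)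
    rwa [hr.eq_of_ae_const p.L₁_lt_L₂ p.Ioo_subset_inner ⟨p.L₁_lt_L₂.le, le_rfl⟩ hA,
      hs.eq_of_ae_const p.L₁_lt_L₂ p.Ioo_subset_inner ⟨p.L₁_lt_L₂.le, le_rfl⟩ hT,
      ht.eq_of_ae_const p.L₂_lt_L₃ p.Ioo_subset_outer_right ⟨le_rfl, p.L₂_lt_L₃.le⟩ hB'] at e
  have hBB : B' = B := mul_left_cancel₀ hb (t2.symm.trans t1)
  rw [hBB] at hB'
  obtain ⟨_, _, _, hP⟩ := U.1.exists_isProfile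
  obtain ⟨_, _, _, hQ⟩ := Z.exists_isProfile
  have s1 := hP.sum_slopes hA hB hB'
  have s2 := hQ.sum_slopes h₀ h₁ h₂
  have hs := slope₂_ne_zero p
  have hL : (p.L₂ : ℂ) - p.L₁ ≠ 0 := by
    rw [← Complex.ofReal_sub]
    exact Complex.ofReal_ne_zero.2 (by linarith [p.L₁_lt_L₂])
  set c : ℂ := B / slope₂ p with hc
  have eB : B = c * slope₂ p := by rw [hc]; field_simp
  have eA : A = c * slope₁ p := by
    refine mul_left_cancel₀ hL ?_
    linear_combination s1 - c * s2 - (p.L₁ + p.L₃ - p.L₂) * eB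
  have eT : T = c * (zeta₃ p : ℝ) := by
    refine mul_left_cancel₀ hm ?_
    linear_combination p.a * eA - t1 - p.b * eB + c * slope_balance p
  have hsub : U.1 - c • Z = 0 := by
    refine StateSpace.eq_zero_of_weakDeriv_eq_zero ?_ ?_ ?_ ?_ ?_ ?_
    · have e : weakDeriv _ U.1.u₁ = c • weakDeriv _ Z.u₁ := by
        refine Lp.ext ?_
        filter_upwards [show ∀ᵐ x ∂(volume.restrict (p.inner : Set ℝ)), _ from hA,
          show ∀ᵐ x ∂(volume.restrict (p.inner : Set ℝ)), _ from h₀,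
          Lp.coeFn_smul c (weakDeriv _ Z.u₁)] with x k1 k2 k3
        rw [k1, k3, Pi.smul_apply, k2, eA, smul_eq_mul]
      have := (weakDeriv p.inner).map_sub U.1.u₁ (c • Z.u₁)
      rw [map_smul, e, sub_self] at this
      exact this
    · have e : weakDeriv _ U.1.v₁ = c • weakDeriv _ Z.v₁ := by
        refine Lp.ext ?_
        have hB'' : ∀ᵐ x ∂(volume.restrict (p.outer : Set ℝ)), weakDeriv _ U.1.v₁ x = B :=
          ae_outer_iff.2 ⟨hB, hB'⟩
        have h₁'' : ∀ᵐ x ∂(volume.restrict (p.outer : Set ℝ)), weakDeriv _ Z.v₁ x = slope₂ p :=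
          ae_outer_iff.2 ⟨h₁, h₂⟩
        filter_upwards [hB'', h₁'', Lp.coeFn_smul c (weakDeriv _ Z.v₁)] with x k1 k2 k3
        rw [k1, k3, Pi.smul_apply, k2, eB, smul_eq_mul]
      have := (weakDeriv p.outer).map_sub U.1.v₁ (c • Z.v₁)
      rw [map_smul, e, sub_self] at this
      exact this
    · have e : U.1.θ = c • Z.θ := by
        refine Lp.ext ?_
        filter_upwards [show ∀ᵐ x ∂(volume.restrict (p.inner : Set ℝ)), _ from hT, hZ.θ,
          Lp.coeFn_smul c Z.θ] with x k1 k2 k3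
        rw [k1, k3, Pi.smul_apply, k2, eT, smul_eq_mul]
      exact sub_eq_zero.2 e
    · change U.1.q - c • Z.q = 0
      rw [hq, hZ.q, smul_zero, sub_zero]
    · change ((generatorDomain.u₂ p U : H1 p.inner) : L2 p.inner) - c • Z.u₂ = 0
      rw [c1, hZ.u₂, smul_zero, sub_zero, ZeroMemClass.coe_zero]
    · change ((generatorDomain.v₂ p U : H1 p.outer) : L2 p.outer) - c • Z.v₂ = 0
      rw [c2, hZ.v₂, smul_zero, sub_zero, ZeroMemClass.coe_zero]
  exact Submodule.mem_span_singleton.2 ⟨c, (sub_eq_zero.1 hsub).symm⟩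

/-! ### Dissipation of the energy -/

theorem integral_inner_add_inner {Ω : Opens ℝ} {f f' g g' : L2 Ω} {F G : ℝ → ℂ} {c d : ℝ}
    (hF : IsPrimitive F f' c d) (hG : IsPrimitive G g' c d)
    (hf : ∀ᵐ x ∂(volume.restrict (Ioo c d)), f x = F x)
    (hg : ∀ᵐ x ∂(volume.restrict (Ioo c d)), g x = G x) :
    ∫ x in Ioo c d, (inner ℂ (f' x) (g x) + inner ℂ (f x) (g' x))
      = starRingEnd ℂ (F d) * G d - starRingEnd ℂ (F c) * G c := by
  rw [← hF.conj.integral_mul hG]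
  refine integral_congr_ae ?_
  filter_upwards [hf, hg] with x h1 h2
  rw [RCLike.inner_apply, RCLike.inner_apply, h1, h2]
  ring

theorem inner_add_inner_inner {f f' g g' : L2 p.inner} {F G : ℝ → ℂ}
    (hF : IsPrimitive F f' p.L₁ p.L₂) (hG : IsPrimitive G g' p.L₁ p.L₂)
    (hf : ∀ᵐ x ∂(volume.restrict (Ioo p.L₁ p.L₂)), f x = F x)
    (hg : ∀ᵐ x ∂(volume.restrict (Ioo p.L₁ p.L₂)), g x = G x) :
    inner ℂ f' g + inner ℂ f g'
      = starRingEnd ℂ (F p.L₂) * G p.L₂ - starRingEnd ℂ (F p.L₁) * G p.L₁ := by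
  rw [L2.inner_def, L2.inner_def, ← integral_add (L2.integrable_inner f' g)
    (L2.integrable_inner f g')]
  exact integral_inner_add_inner hF hG hf hg

theorem inner_add_inner_outer {f f' g g' : L2 p.outer} {F₁ G₁ F₂ G₂ : ℝ → ℂ}
    (hF₁ : IsPrimitive F₁ f' 0 p.L₁) (hG₁ : IsPrimitive G₁ g' 0 p.L₁)
    (hF₂ : IsPrimitive F₂ f' p.L₂ p.L₃) (hG₂ : IsPrimitive G₂ g' p.L₂ p.L₃)
    (hf₁ : ∀ᵐ x ∂(volume.restrict (Ioo 0 p.L₁)), f x = F₁ x)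
    (hg₁ : ∀ᵐ x ∂(volume.restrict (Ioo 0 p.L₁)), g x = G₁ x)
    (hf₂ : ∀ᵐ x ∂(volume.restrict (Ioo p.L₂ p.L₃)), f x = F₂ x)
    (hg₂ : ∀ᵐ x ∂(volume.restrict (Ioo p.L₂ p.L₃)), g x = G₂ x) :
    inner ℂ f' g + inner ℂ f g'
      = (starRingEnd ℂ (F₁ p.L₁) * G₁ p.L₁ - starRingEnd ℂ (F₁ 0) * G₁ 0)
        + (starRingEnd ℂ (F₂ p.L₃) * G₂ p.L₃ - starRingEnd ℂ (F₂ p.L₂) * G₂ p.L₂) := by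
  have hi : Integrable (fun x => (inner ℂ (f' x) (g x) + inner ℂ (f x) (g' x) : ℂ))
      (volume.restrict (p.outer : Set ℝ)) :=
    (L2.integrable_inner f' g).add (L2.integrable_inner f g')
  rw [L2.inner_def, L2.inner_def, ← integral_add (L2.integrable_inner f' g)
    (L2.integrable_inner f g'), integral_outer hi,
    integral_inner_add_inner hF₁ hG₁ hf₁ hg₁, integral_inner_add_inner hF₂ hG₂ hf₂ hg₂]

theorem hasWeakDeriv_stress (U : generatorDomain p) :
    HasWeakDeriv ((p.a : ℂ) • weakDeriv _ U.1.u₁ - (p.m : ℂ) • U.1.θ) (generator p U).u₂ := by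
  rw [generator_u₂]
  have h1 := (hasWeakDeriv_weakDeriv (generatorDomain.du₁ p U)).smul (p.a : ℂ)
  have h2 := (hasWeakDeriv_weakDeriv (generatorDomain.θ p U)).smul (-(p.m : ℂ))
  have h3 := h1.add h2
  rwa [neg_smul, neg_smul, ← sub_eq_add_neg, ← sub_eq_add_neg] at h3

/-- The only dissipation is that of the heat flux; all boundary terms of the integrations by parts
cancel in virtue of the boundary and transmission conditions. -/
theorem re_inner_generator (U : generatorDomain p) :
    (inner ℂ (U : StateSpace p) (generator p U)).re = -‖U.1.q‖ ^ 2 := by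
  obtain ⟨F₀, F₁, F₂, hP⟩ := U.2.matching.exists_isProfile
    (hasWeakDeriv_weakDeriv (generatorDomain.u₂ p U))
    (hasWeakDeriv_weakDeriv (generatorDomain.v₂ p U))
  have dσ := hasWeakDeriv_stress U
  set σ : L2 p.inner := (p.a : ℂ) • weakDeriv _ U.1.u₁ - (p.m : ℂ) • U.1.θ with hσ
  obtain ⟨S, hS, aS⟩ := dσ.exists_isPrimitive p.L₁_lt_L₂ p.Ioo_subset_inner
  obtain ⟨T, hT, aT⟩ := (hasWeakDeriv_weakDeriv (generatorDomain.θ p U)).exists_isPrimitive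
    p.L₁_lt_L₂ p.Ioo_subset_inner
  obtain ⟨Q, hQ, aQ⟩ := (hasWeakDeriv_weakDeriv (generatorDomain.q p U)).exists_isPrimitive
    p.L₁_lt_L₂ p.Ioo_subset_inner
  obtain ⟨W₁, hW₁, aW₁⟩ := (hasWeakDeriv_weakDeriv (generatorDomain.dv₁ p U)).exists_isPrimitive
    p.L₁_pos p.Ioo_subset_outer_left
  obtain ⟨W₂, hW₂, aW₂⟩ := (hasWeakDeriv_weakDeriv (generatorDomain.dv₁ p U)).exists_isPrimitive
    p.L₂_lt_L₃ p.Ioo_subset_outer_right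
  -- the boundary values
  have m1 : p.L₁ ∈ Icc p.L₁ p.L₂ := ⟨le_rfl, p.L₁_lt_L₂.le⟩
  have m2 : p.L₂ ∈ Icc p.L₁ p.L₂ := ⟨p.L₁_lt_L₂.le, le_rfl⟩
  have Q1 : Q p.L₁ = 0 := (U.2.q_trace p.L₁ (by simp)).eq_of_ae_eq p.L₁_lt_L₂ p.Ioo_subset_inner
    m1 hQ.continuousOn aQ
  have Q2 : Q p.L₂ = 0 := (U.2.q_trace p.L₂ (by simp)).eq_of_ae_eq p.L₁_lt_L₂ p.Ioo_subset_inner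
    m2 hQ.continuousOn aQ
  have S1 : S p.L₁ = p.b * W₁ p.L₁ := by
    obtain ⟨r, s, t, hr, hs, ht, e⟩ := U.2.transmission p.L₁ (by simp)
    have := (hr.smul (p.a : ℂ)).add (hs.smul (-(p.m : ℂ)))
    rw [neg_smul, ← sub_eq_add_neg, ← hσ] at this
    rw [this.eq_of_ae_eq p.L₁_lt_L₂ p.Ioo_subset_inner m1 hS.continuousOn aS,
      ht.eq_of_ae_eq p.L₁_pos p.Ioo_subset_outer_left ⟨p.L₁_pos.le, le_rfl⟩ hW₁.continuousOn aW₁,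
      ← e]
    ring
  have S2 : S p.L₂ = p.b * W₂ p.L₂ := by
    obtain ⟨r, s, t, hr, hs, ht, e⟩ := U.2.transmission p.L₂ (by simp)
    have := (hr.smul (p.a : ℂ)).add (hs.smul (-(p.m : ℂ)))
    rw [neg_smul, ← sub_eq_add_neg, ← hσ] at this
    rw [this.eq_of_ae_eq p.L₁_lt_L₂ p.Ioo_subset_inner m2 hS.continuousOn aS,
      ht.eq_of_ae_eq p.L₂_lt_L₃ p.Ioo_subset_outer_right ⟨le_rfl, p.L₂_lt_L₃.le⟩
        hW₂.continuousOn aW₂, ← e]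
    ring
  have e1 := inner_add_inner_inner hS hP.prim₀ aS hP.ae₀
  have e2 := inner_add_inner_inner hT hQ aT aQ
  have e3 := inner_add_inner_outer hW₁ hP.prim₁ hW₂ hP.prim₂ aW₁ hP.ae₁ aW₂ hP.ae₂
  rw [Q1, Q2, mul_zero, mul_zero, sub_zero] at e2
  rw [S1, S2, hP.interface₁, hP.interface₂, map_mul, map_mul, Complex.conj_ofReal] at e1
  rw [hP.left, hP.right, mul_zero, mul_zero, sub_zero, zero_sub] at e3
  have eσ (f : L2 p.inner) : inner ℂ σ f
      = p.a * inner ℂ (weakDeriv _ U.1.u₁) f - p.m * inner ℂ U.1.θ f := by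
    rw [hσ, inner_sub_left, inner_smul_left, inner_smul_left, Complex.conj_ofReal,
      Complex.conj_ofReal]
  rw [eσ] at e1
  have ht : (p.τ : ℂ) ≠ 0 := Complex.ofReal_ne_zero.2 p.τ_pos.ne'
  have total : inner ℂ (U : StateSpace p) (generator p U)
      = p.a * inner ℂ (weakDeriv _ U.1.u₁) (weakDeriv _ (generatorDomain.u₂ p U))
        + inner ℂ U.1.u₂ (generator p U).u₂
        - (p.k * inner ℂ U.1.θ (weakDeriv _ (generatorDomain.q p U))
          + p.m * inner ℂ U.1.θ (weakDeriv _ (generatorDomain.u₂ p U)))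
        - (p.k * inner ℂ U.1.q (weakDeriv _ (generatorDomain.θ p U)) + inner ℂ U.1.q U.1.q)
        + p.b * inner ℂ (weakDeriv _ U.1.v₁) (weakDeriv _ (generatorDomain.v₂ p U))
        + p.b * inner ℂ U.1.v₂ (weakDeriv _ (generatorDomain.dv₁ p U)) := by
    change StateSpace.energyInner _ _ = _
    rw [StateSpace.energyInner, generator_u₁, generator_v₁, generator_θ, generator_q,
      generator_v₂, inner_neg_right, inner_add_right, inner_sub_right, inner_neg_right,
      inner_smul_right, inner_smul_right, inner_smul_right, inner_smul_right, inner_smul_right]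
    field_simp
    ring
  have r1 : (inner ℂ U.1.u₂ (generator p U).u₂ : ℂ).re
      = (inner ℂ (generator p U).u₂ U.1.u₂ : ℂ).re := inner_re_symm (𝕜 := ℂ) _ _
  have r2 : (inner ℂ U.1.q (weakDeriv _ (generatorDomain.θ p U)) : ℂ).re
      = (inner ℂ (weakDeriv _ (generatorDomain.θ p U)) U.1.q : ℂ).re := inner_re_symm (𝕜 := ℂ) _ _
  have r3 : (inner ℂ U.1.v₂ (weakDeriv _ (generatorDomain.dv₁ p U)) : ℂ).re
      = (inner ℂ (weakDeriv _ (generatorDomain.dv₁ p U)) U.1.v₂ : ℂ).re :=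
    inner_re_symm (𝕜 := ℂ) _ _
  have r4 : (inner ℂ U.1.q U.1.q : ℂ).re = ‖U.1.q‖ ^ 2 := inner_self_eq_norm_sq (𝕜 := ℂ) _
  have c1 := congrArg Complex.re e1
  have c2 := congrArg Complex.re e2
  have c3 := congrArg Complex.re e3
  rw [total]
  simp only [Complex.add_re, Complex.sub_re, Complex.neg_re, Complex.re_ofReal_mul, r1, r2, r3, r4,
    mul_assoc, Complex.zero_re] at c1 c2 c3 ⊢
  change _ + (inner ℂ U.1.θ (weakDeriv _ (generatorDomain.q p U)) : ℂ).re = _ at c2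
  change (inner ℂ (generator p U).u₂ U.1.u₂ : ℂ).re + _ = _ at c1
  change (inner ℂ (weakDeriv _ (generatorDomain.dv₁ p U)) U.1.v₂ : ℂ).re
    + (inner ℂ (weakDeriv _ U.1.v₁) (weakDeriv _ (generatorDomain.v₂ p U)) : ℂ).re = _ at c3
  change (inner ℂ (weakDeriv _ (generatorDomain.θ p U)) U.1.q : ℂ).re + _ = _ at c2
  linear_combination c1 - p.k * c2 + p.b * c3

theorem norm_le_norm_sub_generator (U : generatorDomain p) :
    ‖(U : StateSpace p)‖ ≤ ‖(U : StateSpace p) - generator p U‖ := by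
  have h1 : (inner ℂ (U : StateSpace p) ((U : StateSpace p) - generator p U)).re
      = ‖(U : StateSpace p)‖ ^ 2 + ‖U.1.q‖ ^ 2 := by
    rw [inner_sub_right, Complex.sub_re, re_inner_generator, sub_neg_eq_add]
    congr 1
    exact inner_self_eq_norm_sq (𝕜 := ℂ) (U : StateSpace p)
  have h2 : (inner ℂ (U : StateSpace p) ((U : StateSpace p) - generator p U)).re
      ≤ ‖(U : StateSpace p)‖ * ‖(U : StateSpace p) - generator p U‖ :=
    (Complex.re_le_norm _).trans (norm_inner_le_norm _ _)
  by_contra! h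
  have h3 : 0 < ‖(U : StateSpace p)‖ := (norm_nonneg _).trans_lt h
  nlinarith [sq_nonneg ‖U.1.q‖]

/-! ### Injectivity of `z - 𝓐` in the closed right half plane without `0` -/

theorem IsPrimitive.restrict {F g : ℝ → ℂ} {c d x : ℝ} (h : IsPrimitive F g c d) (hcx : c < x)
    (hxd : x ≤ d) : IsPrimitive F g c x :=
  ⟨hcx, h.intervalIntegrable ⟨hcx.le, hxd⟩, fun y hy => h.eq y ⟨hy.1, hy.2.trans hxd⟩⟩

/-- Solutions of `P' = s P` are multiples of `exp (s x)`. -/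
theorem IsPrimitive.eq_zero_of_linear {P : ℝ → ℂ} {s : ℂ} {c d x₀ : ℝ}
    (h : IsPrimitive P (fun t => s * P t) c d) (hx₀ : x₀ ∈ Icc c d) (h₀ : P x₀ = 0) :
    ∀ x ∈ Icc c d, P x = 0 := by
  have key : ∀ x ∈ Icc c d, Complex.exp (-s * x) * P x = Complex.exp (-s * c) * P c := by
    intro x hx
    rcases hx.1.eq_or_lt with rfl | hcx
    · rfl
    have he : IsPrimitive (fun t => Complex.exp (-s * t)) (fun t => -s * Complex.exp (-s * t))
        c x := by
      refine IsPrimitive.of_hasDerivAt hcx (fun y _ => ?_)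
        (Continuous.continuousOn (by fun_prop))
      have h1 : HasDerivAt (fun t : ℝ => -s * (t : ℂ)) (-s) y := by
        simpa using (Complex.ofRealCLM.hasDerivAt (x := y)).const_mul (-s)
      simpa [mul_comm] using h1.cexp
    have := he.integral_mul (h.restrict hcx hx.2)
    rw [show (fun t : ℝ => -s * Complex.exp (-s * t) * P t + Complex.exp (-s * t) * (s * P t))
      = fun _ => 0 from funext fun t => by ring, integral_zero] at this
    linear_combination -this
  intro x hx
  have hc := key x₀ hx₀
  rw [h₀, mul_zero] at hc
  have := key x hx
  rw [← hc] at this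
  exact (mul_eq_zero.1 this).resolve_left (Complex.exp_ne_zero _)

/-- The Cauchy problem for `F'' = s² F`, `s ≠ 0`, with zero data has only the zero solution:
factorize the equation into `(∂ - s)(∂ + s) F = 0` and `(∂ + s)(∂ - s) F = 0`. -/
theorem IsPrimitive.eq_zero_of_second_order {F W : ℝ → ℂ} {s : ℂ} {c d x₀ : ℝ}
    (hF : IsPrimitive F W c d) (hW : IsPrimitive W (fun t => s ^ 2 * F t) c d) (hs : s ≠ 0)
    (hx₀ : x₀ ∈ Icc c d) (h₀ : F x₀ = 0) (h₁ : W x₀ = 0) : ∀ x ∈ Icc c d, F x = 0 := by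
  have k1 : IsPrimitive (fun t => W t + s * F t) (fun t => s * (W t + s * F t)) c d := by
    have := hW.add (hF.const_mul s)
    rwa [show (fun t => s ^ 2 * F t + s * W t) = fun t => s * (W t + s * F t) from
      funext fun t => by ring] at this
  have k2 : IsPrimitive (fun t => W t + -s * F t) (fun t => -s * (W t + -s * F t)) c d := by
    have := hW.add (hF.const_mul (-s))
    rwa [show (fun t => s ^ 2 * F t + -s * W t) = fun t => -s * (W t + -s * F t) from
      funext fun t => by ring] at this
  intro x hx
  have e1 := k1.eq_zero_of_linear hx₀ (by rw [h₀, h₁, mul_zero, add_zero]) x hx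
  have e2 := k2.eq_zero_of_linear hx₀ (by rw [h₀, h₁, mul_zero, add_zero]) x hx
  have e3 : (2 * s) * F x = 0 := by linear_combination e1 - e2
  exact (mul_eq_zero.1 e3).resolve_left (mul_ne_zero two_ne_zero hs)

/-- Unique continuation for the wave equation part: an outer interval at one point of which both
`v¹` and `v¹ₓ` vanish is at rest. -/
theorem ae_eq_zero_of_cauchy_data {Ω : Opens ℝ} {v w w' : L2 Ω} {F : ℝ → ℂ} {s : ℂ} {c d x₀ : ℝ}
    (hsub : Ioo c d ⊆ (Ω : Set ℝ)) (hF : IsPrimitive F w c d)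
    (hv : ∀ᵐ x ∂(volume.restrict (Ioo c d)), v x = F x) (hw : HasWeakDeriv w w') (hs : s ≠ 0)
    (hw' : w' = s ^ 2 • v) (hx₀ : x₀ ∈ Icc c d) (h₀ : F x₀ = 0) (h₁ : HasTrace w x₀ 0) :
    ∀ᵐ x ∂(volume.restrict (Ioo c d)), v x = 0 := by
  obtain ⟨W, hW, aW⟩ := hw.exists_isPrimitive hF.lt hsub
  have hW₀ := h₁.eq_of_ae_eq hF.lt hsub hx₀ hW.continuousOn aW
  have hW' : IsPrimitive W (fun t => s ^ 2 * F t) c d := by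
    refine hW.congr_ae ?_
    filter_upwards [hv, ae_restrict_of_ae_restrict_of_subset hsub (Lp.coeFn_smul (s ^ 2) v)]
      with x h1 h2
    rw [hw', h2, Pi.smul_apply, h1, smul_eq_mul]
  have := (hF.congr_ae aW).eq_zero_of_second_order hW' hs hx₀ h₀ hW₀
  filter_upwards [hv, ae_restrict_mem measurableSet_Ioo] with x h1 h2
  rw [h1, this x (Ioo_subset_Icc_self h2)]

theorem eq_zero_of_generator_eq_smul {z : ℂ} (hz : z ≠ 0) (hre : 0 ≤ z.re) (U : generatorDomain p)
    (hU : generator p U = z • (U : StateSpace p)) : U = 0 := by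
  have hk : (p.k : ℂ) ≠ 0 := Complex.ofReal_ne_zero.2 p.k_pos.ne'
  have hm : (p.m : ℂ) ≠ 0 := Complex.ofReal_ne_zero.2 p.m_pos.ne'
  have hb : (p.b : ℂ) ≠ 0 := Complex.ofReal_ne_zero.2 p.b_pos.ne'
  have ht : (p.τ : ℂ) ≠ 0 := Complex.ofReal_ne_zero.2 p.τ_pos.ne'
  -- the energy identity forces the heat flux to vanish
  have hq : U.1.q = 0 := by
    have h1 := re_inner_generator U
    have h2 : (inner ℂ (U : StateSpace p) (U : StateSpace p))
        = ((‖(U : StateSpace p)‖ ^ 2 : ℝ) : ℂ) := by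
      rw [inner_self_eq_norm_sq_to_K]
      push_cast
      rfl
    rw [hU, inner_smul_right, h2, mul_comm, Complex.re_ofReal_mul] at h1
    have h3 : 0 ≤ ‖(U : StateSpace p)‖ ^ 2 * z.re := by positivity
    have h4 : ‖U.1.q‖ ^ 2 = 0 := le_antisymm (by linarith) (sq_nonneg _)
    simpa using h4
  have hqd : generatorDomain.q p U = 0 := Subtype.ext hq
  have c1 : generatorDomain.u₂ p U = z • U.1.u₁ := congrArg StateSpace.u₁ hU
  have c2 : generatorDomain.v₂ p U = z • U.1.v₁ := congrArg StateSpace.v₁ hU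
  have c3 : (generator p U).θ = z • U.1.θ := congrArg StateSpace.θ hU
  have c4 : (generator p U).q = z • U.1.q := congrArg StateSpace.q hU
  have c5 : (generator p U).u₂ = z • U.1.u₂ := congrArg StateSpace.u₂ hU
  have c6 : (generator p U).v₂ = z • U.1.v₂ := congrArg StateSpace.v₂ hU
  have hu₂ : U.1.u₂ = z • (U.1.u₁ : L2 p.inner) := congrArg Subtype.val c1
  have hv₂ : U.1.v₂ = z • (U.1.v₁ : L2 p.outer) := congrArg Subtype.val c2
  rw [generator_q, hq, smul_zero, sub_zero, smul_zero, neg_eq_zero,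
    smul_eq_zero_iff_right (div_ne_zero hk ht)] at c4
  -- the temperature is proportional to the strain
  have hθ : U.1.θ = -((p.m : ℂ) • weakDeriv _ U.1.u₁) := by
    rw [generator_θ, hqd, map_zero, smul_zero, zero_add, c1, map_smul, smul_comm,
      ← smul_neg] at c3
    exact (smul_right_injective _ hz c3).symm
  have hdu : generatorDomain.du₁ p U = (-(p.m : ℂ)⁻¹) • generatorDomain.θ p U := by
    refine Subtype.ext ?_
    change weakDeriv _ U.1.u₁ = (-(p.m : ℂ)⁻¹) • U.1.θ
    rw [hθ, smul_neg, neg_smul, neg_neg, smul_smul, inv_mul_cancel₀ hm, one_smul]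
  rw [generator_u₂, hdu, map_smul, c4, smul_zero, smul_zero, smul_zero, sub_zero, eq_comm,
    smul_eq_zero_iff_right hz] at c5
  have hu₁ : U.1.u₁ = 0 := by
    rw [hu₂, smul_eq_zero_iff_right hz] at c5
    exact Subtype.ext c5
  have hu₁x : weakDeriv _ U.1.u₁ = 0 := by rw [hu₁, map_zero]
  have hθ0 : U.1.θ = 0 := by rw [hθ, hu₁x, smul_zero, neg_zero]
  -- hence no stress reaches the outer part through the interfaces
  have hw : ∀ x ∈ ({p.L₁, p.L₂} : Set ℝ), HasTrace (weakDeriv _ U.1.v₁) x 0 := by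
    intro x hx
    have hx' : x ∈ Icc p.L₁ p.L₂ := by
      rcases hx with rfl | rfl
      · exact ⟨le_rfl, p.L₁_lt_L₂.le⟩
      · exact ⟨p.L₁_lt_L₂.le, le_rfl⟩
    obtain ⟨r, s, t, hr, hs, ht, e⟩ := U.2.transmission x hx
    have h0 := Lp.coeFn_zero ℂ 2 (volume.restrict (p.inner : Set ℝ))
    rw [hu₁x] at hr
    rw [hθ0] at hs
    have er := hr.eq_of_ae_const p.L₁_lt_L₂ p.Ioo_subset_inner hx' (C := 0) h0
    have es := hs.eq_of_ae_const p.L₁_lt_L₂ p.Ioo_subset_inner hx' (C := 0) h0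
    rw [er, es, mul_zero, mul_zero, sub_zero, eq_comm] at e
    rwa [(mul_eq_zero.1 e).resolve_left hb] at ht
  obtain ⟨F₀, F₁, F₂, hP⟩ := U.1.exists_isProfile
  have hF₀ : ∀ x ∈ Icc p.L₁ p.L₂, F₀ x = 0 := by
    refine eqOn_Icc_of_ae_eq (G := fun _ => 0) p.L₁_lt_L₂ hP.prim₀.continuousOn
      continuousOn_const ?_
    have h1 := hP.ae₀
    rw [hu₁] at h1
    filter_upwards [h1, show ∀ᵐ x ∂(volume.restrict (Ioo p.L₁ p.L₂)), _ from
      Lp.coeFn_zero ℂ 2 (volume.restrict (p.inner : Set ℝ))] with x h2 h3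
    rw [← h2]
    exact h3
  obtain ⟨s, hs⟩ : ∃ s : ℂ, s ^ 2 = z ^ 2 / p.b :=
    IsAlgClosed.exists_pow_nat_eq _ two_pos
  have hs0 : s ≠ 0 := by
    rintro rfl
    exact div_ne_zero (pow_ne_zero 2 hz) hb (by rw [← hs]; simp)
  have hwd := hasWeakDeriv_weakDeriv (generatorDomain.dv₁ p U)
  have hwe : weakDeriv _ (generatorDomain.dv₁ p U) = s ^ 2 • (U.1.v₁ : L2 p.outer) := by
    rw [generator_v₂, hv₂] at c6
    refine smul_right_injective _ hb ?_
    change (p.b : ℂ) • weakDeriv _ (generatorDomain.dv₁ p U) = _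
    change _ = (p.b : ℂ) • s ^ 2 • (U.1.v₁ : L2 p.outer)
    rw [c6, hs, smul_smul, smul_smul]
    congr 1
    field_simp
  have a1 := ae_eq_zero_of_cauchy_data p.Ioo_subset_outer_left hP.prim₁ hP.ae₁ hwd hs0 hwe
    ⟨p.L₁_pos.le, le_rfl⟩ (by rw [← hP.interface₁]; exact hF₀ _ ⟨le_rfl, p.L₁_lt_L₂.le⟩)
    (hw _ (by simp))
  have a2 := ae_eq_zero_of_cauchy_data p.Ioo_subset_outer_right hP.prim₂ hP.ae₂ hwd hs0 hwe
    ⟨le_rfl, p.L₂_lt_L₃.le⟩ (by rw [← hP.interface₂]; exact hF₀ _ ⟨p.L₁_lt_L₂.le, le_rfl⟩)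
    (hw _ (by simp))
  have hv₁ : U.1.v₁ = 0 := by
    refine Subtype.ext (Lp.ext ?_)
    filter_upwards [ae_outer_iff.2 ⟨a1, a2⟩,
      Lp.coeFn_zero ℂ 2 (volume.restrict (p.outer : Set ℝ))] with x h1 h2
    exact h1.trans h2.symm
  refine Subtype.ext (StateSpace.ext hu₁ hv₁ hθ0 hq c5 ?_)
  rw [hv₂, hv₁, ZeroMemClass.coe_zero, smul_zero]
  rfl

/-! ### Linear systems with integrable forcing -/

/-- Global solvability of `w' = L w + h` for continuous `h`, by variation of constants. -/
theorem exists_linear_ode_continuous {E : Type*} [NormedAddCommGroup E] [NormedSpace ℝ E]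
    [CompleteSpace E] (L : E →L[ℝ] E) {h : ℝ → E} (hh : Continuous h) (c : ℝ) (w₀ : E) :
    ∃ w : ℝ → E, w c = w₀ ∧ ∀ x, HasDerivAt w (L (w x) + h x) x := by
  set S : ℝ → E →L[ℝ] E := fun t => NormedSpace.exp (t • L) with hS
  have hSd : ∀ t, HasDerivAt S (L * S t) t := fun t => hasDerivAt_exp_smul_const' L t
  have hSc : Continuous S := continuous_iff_continuousAt.2 fun t => (hSd t).continuousAt
  have hinv : ∀ t v, S t (S (-t) v) = v := by
    intro t v
    have e : S t * S (-t) = 1 := by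
      let _ : NormedAlgebra ℚ (E →L[ℝ] E) := NormedAlgebra.restrictScalars ℚ ℝ _
      rw [hS]
      simp only
      rw [neg_smul, ← NormedSpace.exp_add_of_commute (Commute.neg_right (Commute.refl _)),
        add_neg_cancel, NormedSpace.exp_zero]
    exact congrArg (fun T : E →L[ℝ] E => T v) e
  have hk : Continuous fun s => S (-s) (h s) := (hSc.comp continuous_neg).clm_apply hh
  refine ⟨fun x => S x (S (-c) w₀ + ∫ s in c..x, S (-s) (h s)), by simp [hinv], fun x => ?_⟩
  have h1 := (hk.integral_hasStrictDerivAt c x).hasDerivAt.const_add (S (-c) w₀)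
  have h2 := (hSd x).clm_apply h1
  rw [hinv] at h2
  exact h2

/-- Solvability of `y' = A y + g` for integrable `g`: the difference of `y` and a primitive of `g`
solves a system with continuous forcing. -/
theorem exists_linear_system {ι : Type*} [Fintype ι] [DecidableEq ι] (A : Matrix ι ι ℂ)
    {g : ι → ℝ → ℂ} {c d : ℝ} (hcd : c < d) (hg : ∀ i, IntervalIntegrable (g i) volume c d)
    (y₀ : ι → ℂ) : ∃ y : ι → ℝ → ℂ, ∀ i, y i c = y₀ i ∧
      IsPrimitive (y i) (fun t => ∑ j, A i j * y j t + g i t) c d := by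
  set L : (ι → ℂ) →L[ℝ] (ι → ℂ) :=
    ((Matrix.toLin' A).toContinuousLinearMap).restrictScalars ℝ with hL
  have hLa : ∀ v i, L v i = ∑ j, A i j * v j := fun v i => rfl
  set G : ℝ → ι → ℂ := fun x i => ∫ t in c..x, (Ioc c d).indicator (g i) t with hG
  have hGc : Continuous G := by
    refine continuous_pi fun i => ?_
    exact ((hg i).1.integrable_indicator measurableSet_Ioc).continuous_primitive c
  have hGp : ∀ i, IsPrimitive (fun x => G x i) (g i) c d := by
    intro i
    refine ⟨hcd, hg i, fun x hx => ?_⟩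
    simp only [hG, intervalIntegral.integral_same, zero_add]
    refine intervalIntegral.integral_congr_ae (ae_of_all _ fun t ht => ?_)
    rw [uIoc_of_le hx.1] at ht
    have ht' : t ∈ Ioc c d := ⟨ht.1, ht.2.trans hx.2⟩
    rw [indicator_of_mem ht']
  obtain ⟨w, hwc, hw⟩ := exists_linear_ode_continuous L (L.continuous.comp hGc) c y₀
  have hwcont : Continuous w := continuous_iff_continuousAt.2 fun x => (hw x).continuousAt
  refine ⟨fun i x => w x i + G x i, fun i => ⟨by simp [hwc, hG], ?_⟩⟩
  have hwp : IsPrimitive (fun x => w x i) (fun x => ∑ j, A i j * (w x j + G x j)) c d := by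
    refine IsPrimitive.of_hasDerivAt hcd (fun x _ => ?_) (Continuous.continuousOn (by fun_prop))
    have := hasDerivAt_pi.1 (hw x) i
    rwa [Pi.add_apply, Function.comp_apply, hLa, hLa, ← Finset.sum_add_distrib,
      Finset.sum_congr rfl fun j _ => (mul_add (A i j) (w x j) (G x j)).symm] at this
  exact hwp.add (hGp i)

/-! ### The resolvent equation as a first order system -/

/-- The unknowns of the first order system: on `[L₁, L₂]` the displacement `u`, the stress
`σ = a uₓ - m θ`, the temperature `θ` and the heat flux `q`; on `[0, L₁]` and `[L₂, L₃]` the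
displacement `v` and the stress `w = b vₓ`. -/
structure BarFields where
  (u σ θ q v₁ w₁ v₂ w₂ : ℝ → ℂ)

/-- `Y` solves the first order system for `(z - 𝓐) U = F`, with the forcing terms `gσ`, `gθ`, `gq`
and `gw` computed from `F`, and satisfies all boundary and transmission conditions except
`q(L₂) = 0` and `v(L₃) = 0`. -/
structure IsShooting (p : BarParameters) (z : ℂ) (gσ gθ gq : L2 p.inner) (gw : L2 p.outer)
    (Y : BarFields) : Prop where
  u : IsPrimitive Y.u (fun t => 1 / p.a * (Y.σ t + p.m * Y.θ t)) p.L₁ p.L₂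
  σ : IsPrimitive Y.σ (fun t => z ^ 2 * Y.u t + gσ t) p.L₁ p.L₂
  θ : IsPrimitive Y.θ (fun t => -((p.τ * z + 1) / p.k) * Y.q t + gθ t) p.L₁ p.L₂
  q : IsPrimitive Y.q (fun t => -(z / p.k) * Y.θ t
    + -(p.m * z / (p.k * p.a)) * (Y.σ t + p.m * Y.θ t) + gq t) p.L₁ p.L₂
  v₁ : IsPrimitive Y.v₁ (fun t => 1 / p.b * Y.w₁ t) 0 p.L₁
  w₁ : IsPrimitive Y.w₁ (fun t => z ^ 2 * Y.v₁ t + gw t) 0 p.L₁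
  v₂ : IsPrimitive Y.v₂ (fun t => 1 / p.b * Y.w₂ t) p.L₂ p.L₃
  w₂ : IsPrimitive Y.w₂ (fun t => z ^ 2 * Y.v₂ t + gw t) p.L₂ p.L₃
  left : Y.v₁ 0 = 0
  displacement₁ : Y.u p.L₁ = Y.v₁ p.L₁
  stress₁ : Y.σ p.L₁ = Y.w₁ p.L₁
  flux₁ : Y.q p.L₁ = 0
  displacement₂ : Y.u p.L₂ = Y.v₂ p.L₂
  stress₂ : Y.σ p.L₂ = Y.w₂ p.L₂

/-- The shooting parameters are the stress at `0` and the temperature at `L₁`. -/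
theorem exists_isShooting (p : BarParameters) (z : ℂ) (gσ gθ gq : L2 p.inner) (gw : L2 p.outer)
    (s t : ℂ) : ∃ Y : BarFields, IsShooting p z gσ gθ gq gw Y ∧ Y.w₁ 0 = s ∧ Y.θ p.L₁ = t := by
  have i₁ := intervalIntegrable_of_Ioo_subset gw p.L₁_pos.le p.Ioo_subset_outer_left
  have i₂ := intervalIntegrable_of_Ioo_subset gw p.L₂_lt_L₃.le p.Ioo_subset_outer_right
  have i₀ (f : L2 p.inner) : IntervalIntegrable f volume p.L₁ p.L₂ :=
    intervalIntegrable_of_Ioo_subset f p.L₁_lt_L₂.le p.Ioo_subset_inner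
  have hz : ∀ c d : ℝ, IntervalIntegrable (fun _ => (0 : ℂ)) volume c d :=
    fun c d => intervalIntegrable_const
  -- the coefficient matrices for `(v, w)` and for `(u, σ, θ, q)`
  set B : Matrix (Fin 2) (Fin 2) ℂ := !![0, 1 / p.b; z ^ 2, 0]
  set A : Matrix (Fin 4) (Fin 4) ℂ := !![0, 1 / p.a, p.m / p.a, 0; z ^ 2, 0, 0, 0;
    0, 0, 0, -((p.τ * z + 1) / p.k);
    0, -(p.m * z / (p.k * p.a)), -(z / p.k) - p.m * z / (p.k * p.a) * p.m, 0]
  obtain ⟨y, hy⟩ := exists_linear_system B (g := ![fun _ => 0, gw]) p.L₁_pos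
    (by
      rw [Fin.forall_fin_two]
      exact ⟨hz _ _, i₁⟩) ![0, s]
  obtain ⟨Y, hY⟩ := exists_linear_system A (g := ![fun _ => 0, gσ, gθ, gq]) p.L₁_lt_L₂
    (by
      intro i
      fin_cases i
      exacts [hz _ _, i₀ _, i₀ _, i₀ _]) ![y 0 p.L₁, y 1 p.L₁, t, 0]
  obtain ⟨y', hy'⟩ := exists_linear_system B (g := ![fun _ => 0, gw]) p.L₂_lt_L₃
    (by
      rw [Fin.forall_fin_two]
      exact ⟨hz _ _, i₂⟩) ![Y 0 p.L₂, Y 1 p.L₂]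
  refine ⟨⟨Y 0, Y 1, Y 2, Y 3, y 0, y 1, y' 0, y' 1⟩, ⟨?_, ?_, ?_, ?_, ?_, ?_, ?_, ?_, (hy 0).1,
    (hY 0).1, (hY 1).1, (hY 3).1, (hy' 0).1.symm, (hy' 1).1.symm⟩, (hy 1).1, (hY 2).1⟩
  · convert (hY 0).2 using 2
    simp [A, Fin.sum_univ_four]
    ring
  · convert (hY 1).2 using 2
    simp [A, Fin.sum_univ_four]
  · convert (hY 2).2 using 2
    simp [A, Fin.sum_univ_four]
  · convert (hY 3).2 using 2
    simp [A, Fin.sum_univ_four]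
    ring
  · convert (hy 0).2 using 2
    simp [B]
  · convert (hy 1).2 using 2
    simp [B]
  · convert (hy' 0).2 using 2
    simp [B]
  · convert (hy' 1).2 using 2
    simp [B]

/-- The combination `Y + s Z`. -/
def BarFields.addSMul (Y : BarFields) (s : ℂ) (Z : BarFields) : BarFields where
  u x := Y.u x + s * Z.u x
  σ x := Y.σ x + s * Z.σ x
  θ x := Y.θ x + s * Z.θ x
  q x := Y.q x + s * Z.q x
  v₁ x := Y.v₁ x + s * Z.v₁ x
  w₁ x := Y.w₁ x + s * Z.w₁ x
  v₂ x := Y.v₂ x + s * Z.v₂ x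
  w₂ x := Y.w₂ x + s * Z.w₂ x

theorem IsShooting.addSMul {z : ℂ} {gσ gθ gq : L2 p.inner} {gw : L2 p.outer} {Y Z : BarFields}
    (hY : IsShooting p z gσ gθ gq gw Y) (hZ : IsShooting p z 0 0 0 0 Z) (s : ℂ) :
    IsShooting p z gσ gθ gq gw (Y.addSMul s Z) := by
  have h₀ : ∀ᵐ x ∂(volume.restrict (Ioo p.L₁ p.L₂)), (0 : L2 p.inner) x = 0 :=
    Lp.coeFn_zero ℂ 2 (volume.restrict (p.inner : Set ℝ))
  obtain ⟨h₁, h₂⟩ : (∀ᵐ x ∂(volume.restrict (Ioo 0 p.L₁)), (0 : L2 p.outer) x = 0) ∧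
      ∀ᵐ x ∂(volume.restrict (Ioo p.L₂ p.L₃)), (0 : L2 p.outer) x = 0 :=
    ae_outer_iff.1 (Lp.coeFn_zero ℂ 2 (volume.restrict (p.outer : Set ℝ)))
  refine ⟨(hY.u.add (hZ.u.const_mul s)).congr_ae (ae_of_all _ fun x => ?_),
    (hY.σ.add (hZ.σ.const_mul s)).congr_ae (h₀.mono fun x hx => ?_),
    (hY.θ.add (hZ.θ.const_mul s)).congr_ae (h₀.mono fun x hx => ?_),
    (hY.q.add (hZ.q.const_mul s)).congr_ae (h₀.mono fun x hx => ?_),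
    (hY.v₁.add (hZ.v₁.const_mul s)).congr_ae (ae_of_all _ fun x => ?_),
    (hY.w₁.add (hZ.w₁.const_mul s)).congr_ae (h₁.mono fun x hx => ?_),
    (hY.v₂.add (hZ.v₂.const_mul s)).congr_ae (ae_of_all _ fun x => ?_),
    (hY.w₂.add (hZ.w₂.const_mul s)).congr_ae (h₂.mono fun x hx => ?_), ?_, ?_, ?_, ?_, ?_, ?_⟩ <;>
    simp only [BarFields.addSMul]
  · ring
  · rw [hx]; ring
  · rw [hx]; ring
  · rw [hx]; ring
  · ring
  · rw [hx]; ring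
  · ring
  · rw [hx]; ring
  · rw [hY.left, hZ.left, mul_zero, add_zero]
  · rw [hY.displacement₁, hZ.displacement₁]
  · rw [hY.stress₁, hZ.stress₁]
  · rw [hY.flux₁, hZ.flux₁, mul_zero, add_zero]
  · rw [hY.displacement₂, hZ.displacement₂]
  · rw [hY.stress₂, hZ.stress₂]

/-! ### Surjectivity by shooting -/

/-- A solution of the first order system which also satisfies the two remaining boundary conditions
gives a solution of the resolvent equation. -/
theorem IsShooting.exists_solution {z : ℂ} {gσ gθ gq : L2 p.inner} {gw : L2 p.outer}
    {Y : BarFields} (hY : IsShooting p z gσ gθ gq gw Y) (hq : Y.q p.L₂ = 0) (hv : Y.v₂ p.L₃ = 0)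
    (F : StateSpace p) (hσ : gσ = -(z • (F.u₁ : L2 p.inner)) - F.u₂)
    (hθ : gθ = (p.τ / p.k : ℂ) • F.q)
    (hgq : gq = (1 / p.k : ℂ) • (F.θ + (p.m : ℂ) • weakDeriv _ F.u₁))
    (hw : gw = -(z • (F.v₁ : L2 p.outer)) - F.v₂) :
    ∃ U : generatorDomain p, z • (U : StateSpace p) - generator p U = F ∧
      (∀ᵐ x ∂(volume.restrict (Ioo p.L₁ p.L₂)), U.1.θ x = Y.θ x) ∧
      ∀ᵐ x ∂(volume.restrict (Ioo 0 p.L₁)), weakDeriv _ U.1.v₁ x = 1 / p.b * Y.w₁ x := by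
  have hk : (p.k : ℂ) ≠ 0 := Complex.ofReal_ne_zero.2 p.k_pos.ne'
  have ha : (p.a : ℂ) ≠ 0 := Complex.ofReal_ne_zero.2 p.a_pos.ne'
  have hb : (p.b : ℂ) ≠ 0 := Complex.ofReal_ne_zero.2 p.b_pos.ne'
  have ht : (p.τ : ℂ) ≠ 0 := Complex.ofReal_ne_zero.2 p.τ_pos.ne'
  obtain ⟨u, au⟩ := exists_L2_inner hY.u.continuousOn
  obtain ⟨σ, aσ⟩ := exists_L2_inner hY.σ.continuousOn
  obtain ⟨θ, aθ⟩ := exists_L2_inner hY.θ.continuousOn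
  obtain ⟨q, aq⟩ := exists_L2_inner hY.q.continuousOn
  obtain ⟨v, av₁, av₂⟩ := exists_L2_outer hY.v₁.continuousOn hY.v₂.continuousOn
  obtain ⟨w, aw₁, aw₂⟩ := exists_L2_outer hY.w₁.continuousOn hY.w₂.continuousOn
  set ux : L2 p.inner := (1 / p.a : ℂ) • (σ + (p.m : ℂ) • θ) with hux
  have aux : ∀ᵐ x ∂(volume.restrict (Ioo p.L₁ p.L₂)),
      ux x = 1 / p.a * (Y.σ x + p.m * Y.θ x) := by
    filter_upwards [aσ, aθ, Lp.coeFn_smul (1 / p.a : ℂ) (σ + (p.m : ℂ) • θ),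
      Lp.coeFn_add σ ((p.m : ℂ) • θ), Lp.coeFn_smul (p.m : ℂ) θ] with x h1 h2 h3 h4 h5
    rw [h3, Pi.smul_apply, h4, Pi.add_apply, h5, Pi.smul_apply, h1, h2, smul_eq_mul, smul_eq_mul]
  obtain ⟨awx₁, awx₂⟩ := ae_outer_iff.1 (Lp.coeFn_smul (1 / p.b : ℂ) w)
  have awx₁' : ∀ᵐ x ∂(volume.restrict (Ioo 0 p.L₁)), ((1 / p.b : ℂ) • w) x = 1 / p.b * Y.w₁ x := by
    filter_upwards [aw₁, awx₁] with x h1 h2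
    rw [h2, Pi.smul_apply, h1, smul_eq_mul]
  have awx₂' : ∀ᵐ x ∂(volume.restrict (Ioo p.L₂ p.L₃)),
      ((1 / p.b : ℂ) • w) x = 1 / p.b * Y.w₂ x := by
    filter_upwards [aw₂, awx₂] with x h1 h2
    rw [h2, Pi.smul_apply, h1, smul_eq_mul]
  have hP : IsProfile u ux v ((1 / p.b : ℂ) • w) Y.u Y.v₁ Y.v₂ :=
    ⟨hY.u.congr_ae (aux.mono fun x hx => hx.symm), hY.v₁.congr_ae (awx₁'.mono fun x hx => hx.symm),
      hY.v₂.congr_ae (awx₂'.mono fun x hx => hx.symm), au, av₁, av₂, hY.left, hv,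
      hY.displacement₁, hY.displacement₂⟩
  have du := hP.hasWeakDeriv_left
  have dv := hP.hasWeakDeriv_right
  have dσ : HasWeakDeriv σ (z ^ 2 • u + gσ) := by
    refine hasWeakDeriv_inner (hY.σ.congr_ae ?_) aσ
    filter_upwards [au, Lp.coeFn_add (z ^ 2 • u) gσ, Lp.coeFn_smul (z ^ 2) u] with x h1 h2 h3
    rw [h2, Pi.add_apply, h3, Pi.smul_apply, h1, smul_eq_mul]
  have dθ : HasWeakDeriv θ (-((p.τ * z + 1) / p.k) • q + gθ) := by
    refine hasWeakDeriv_inner (hY.θ.congr_ae ?_) aθ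
    filter_upwards [aq, Lp.coeFn_add (-((p.τ * z + 1) / p.k) • q) gθ,
      Lp.coeFn_smul (-((p.τ * z + 1) / p.k)) q] with x h1 h2 h3
    rw [h2, Pi.add_apply, h3, Pi.smul_apply, h1, smul_eq_mul]
  have dq : HasWeakDeriv q (-(z / p.k) • θ + (-(p.m * z / p.k)) • ux + gq) := by
    refine hasWeakDeriv_inner (hY.q.congr_ae ?_) aq
    filter_upwards [aθ, aux, Lp.coeFn_add (-(z / p.k) • θ + (-(p.m * z / p.k)) • ux) gq,
      Lp.coeFn_add (-(z / p.k) • θ) ((-(p.m * z / p.k)) • ux), Lp.coeFn_smul (-(z / p.k)) θ,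
      Lp.coeFn_smul (-(p.m * z / p.k)) ux] with x h1 h2 h3 h4 h5 h6
    rw [h3, Pi.add_apply, h4, Pi.add_apply, h5, h6, Pi.smul_apply, Pi.smul_apply, h1, h2,
      smul_eq_mul, smul_eq_mul]
    field_simp
  have dw : HasWeakDeriv w (z ^ 2 • v + gw) := by
    obtain ⟨k1, k1'⟩ := ae_outer_iff.1 (Lp.coeFn_add (z ^ 2 • v) gw)
    obtain ⟨k2, k2'⟩ := ae_outer_iff.1 (Lp.coeFn_smul (z ^ 2) v)
    refine hasWeakDeriv_outer (hY.w₁.congr_ae ?_) (hY.w₂.congr_ae ?_) aw₁ aw₂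
    · filter_upwards [av₁, k1, k2] with x h1 h2 h3
      rw [h2, Pi.add_apply, h3, Pi.smul_apply, h1, smul_eq_mul]
    · filter_upwards [av₂, k1', k2'] with x h1 h2 h3
      rw [h2, Pi.add_apply, h3, Pi.smul_apply, h1, smul_eq_mul]
  -- the velocities are determined by the first two equations, `z u¹ - u² = f¹` and `z v¹ - v² = f²`
  obtain ⟨U, U1, U2, U3, U4, U5, U6, U7, U8⟩ :=
    hP.exists_state θ q (z • u - (F.u₁ : L2 p.inner)) (z • v - (F.v₁ : L2 p.outer))
  have dux : HasWeakDeriv ux ((1 / p.a : ℂ) • ((z ^ 2 • u + gσ)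
      + (p.m : ℂ) • (-((p.τ * z + 1) / p.k) • q + gθ))) :=
    (dσ.add (dθ.smul (p.m : ℂ))).smul (1 / p.a : ℂ)
  have dvx := dw.smul (1 / p.b : ℂ)
  have du₂ : HasWeakDeriv (z • u - (F.u₁ : L2 p.inner)) (z • ux - weakDeriv _ F.u₁) := by
    have := (du.smul z).add ((hasWeakDeriv_weakDeriv F.u₁).smul (-1))
    rwa [neg_one_smul, neg_one_smul, ← sub_eq_add_neg, ← sub_eq_add_neg] at this
  have dv₂ : HasWeakDeriv (z • v - (F.v₁ : L2 p.outer))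
      (z • (1 / p.b : ℂ) • w - weakDeriv _ F.v₁) := by
    have := (dv.smul z).add ((hasWeakDeriv_weakDeriv F.v₁).smul (-1))
    rwa [neg_one_smul, neg_one_smul, ← sub_eq_add_neg, ← sub_eq_add_neg] at this
  have hdom : InDomain p U := by
    refine ⟨?_, ?_, ?_, ?_, ?_, ?_, ?_, fun x hx => ?_, fun x hx => ?_⟩
    · rw [U3]; exact dux.mem_H1
    · rw [U4]; exact dvx.mem_H1
    · rw [U5]; exact dθ.mem_H1
    · rw [U6]; exact dq.mem_H1
    · rw [U7]; exact du₂.mem_H1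
    · rw [U8]; exact dv₂.mem_H1
    · rw [U7, U8]
      have := (hP.matching.smul z).add (F.matching.smul (-1))
      rwa [neg_one_smul, neg_one_smul, ← sub_eq_add_neg, ← sub_eq_add_neg] at this
    · rw [U6]
      have := hasTrace_inner hY.q.continuousOn aq x
      rcases hx with rfl | rfl
      · rwa [hY.flux₁] at this
      · rwa [hq] at this
    · rw [U3, U4, U5]
      have t1 := hasTrace_inner hY.σ.continuousOn aσ x
      have t2 := hasTrace_inner hY.θ.continuousOn aθ x
      have t3 := hasTrace_outer hY.w₁.continuousOn hY.w₂.continuousOn aw₁ aw₂ x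
      have e : glue p Y.w₁ Y.w₂ x = Y.σ x := by
        rcases hx with rfl | rfl
        · rw [glue_left le_rfl, hY.stress₁]
        · rw [glue_right le_rfl, hY.stress₂]
      rw [e] at t3
      refine ⟨_, _, _, (t1.add (t2.smul (p.m : ℂ))).smul (1 / p.a : ℂ), t2,
        t3.smul (1 / p.b : ℂ), ?_⟩
      field_simp
      ring
  set V : generatorDomain p := ⟨U, hdom⟩ with hV
  have w1 : weakDeriv _ (generatorDomain.du₁ p V) = _ := weakDeriv_eq (f := generatorDomain.du₁ p V)
    (by rw [← U3] at dux; exact dux)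
  have w2 : weakDeriv _ (generatorDomain.dv₁ p V) = _ := weakDeriv_eq (f := generatorDomain.dv₁ p V)
    (by rw [← U4] at dvx; exact dvx)
  have w3 : weakDeriv _ (generatorDomain.θ p V) = -((p.τ * z + 1) / p.k) • q + gθ :=
    weakDeriv_eq (f := generatorDomain.θ p V) (by rw [← U5] at dθ; exact dθ)
  have w4 : weakDeriv _ (generatorDomain.q p V)
      = -(z / p.k) • θ + (-(p.m * z / p.k)) • ux + gq :=
    weakDeriv_eq (f := generatorDomain.q p V) (by rw [← U6] at dq; exact dq)
  have w5 : weakDeriv _ (generatorDomain.u₂ p V) = z • ux - weakDeriv _ F.u₁ :=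
    weakDeriv_eq (f := generatorDomain.u₂ p V) (by rw [← U7] at du₂; exact du₂)
  refine ⟨V, StateSpace.ext (Subtype.ext ?_) (Subtype.ext ?_) ?_ ?_ ?_ ?_, ?_, ?_⟩
  · change z • (U.u₁ : L2 p.inner) - U.u₂ = F.u₁
    rw [U1, U7, sub_sub_cancel]
  · change z • (U.v₁ : L2 p.outer) - U.v₂ = F.v₁
    rw [U2, U8, sub_sub_cancel]
  · change z • U.θ - (generator p V).θ = F.θ
    rw [generator_θ, w4, w5, U5, hgq]
    match_scalars <;> field_simp <;> ring
  · change z • U.q - (generator p V).q = F.q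
    rw [generator_q, w3, hθ]
    change z • U.q - (_ - (1 / p.τ : ℂ) • U.q) = F.q
    rw [U6]
    match_scalars <;> field_simp
    ring
  · change z • U.u₂ - (generator p V).u₂ = F.u₂
    rw [generator_u₂, w1, w3, U7, hσ]
    match_scalars <;> field_simp <;> ring
  · change z • U.v₂ - (generator p V).v₂ = F.v₂
    rw [generator_v₂, w2, U8, hw]
    match_scalars <;> field_simp <;> ring
  · change ∀ᵐ x ∂(volume.restrict (Ioo p.L₁ p.L₂)), U.θ x = Y.θ x
    rw [U5]
    exact aθ
  · change ∀ᵐ x ∂(volume.restrict (Ioo 0 p.L₁)), weakDeriv _ U.v₁ x = 1 / p.b * Y.w₁ x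
    rw [U4]
    exact awx₁'

/-- Shooting: the two missing boundary values depend in an affine way on the two shooting
parameters, and injectivity of `z - 𝓐` makes the linear part of this dependence invertible. -/
theorem exists_sub_generator_eq {z : ℂ} (hz : z ≠ 0) (hre : 0 ≤ z.re) (F : StateSpace p) :
    ∃ U : generatorDomain p, z • (U : StateSpace p) - generator p U = F := by
  obtain ⟨Y₀, h₀, -, -⟩ := exists_isShooting p z (-(z • (F.u₁ : L2 p.inner)) - F.u₂)
    ((p.τ / p.k : ℂ) • F.q) ((1 / p.k : ℂ) • (F.θ + (p.m : ℂ) • weakDeriv _ F.u₁))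
    (-(z • (F.v₁ : L2 p.outer)) - F.v₂) 0 0
  obtain ⟨Y₁, h₁, s₁, t₁⟩ := exists_isShooting p z 0 0 0 0 1 0
  obtain ⟨Y₂, h₂, s₂, t₂⟩ := exists_isShooting p z 0 0 0 0 0 1
  have hb : (p.b : ℂ) ≠ 0 := Complex.ofReal_ne_zero.2 p.b_pos.ne'
  -- a homogeneous solution satisfying all boundary conditions has vanishing shooting parameters
  have hom : ∀ Y : BarFields, IsShooting p z 0 0 0 0 Y → Y.q p.L₂ = 0 → Y.v₂ p.L₃ = 0 →
      Y.w₁ 0 = 0 ∧ Y.θ p.L₁ = 0 := by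
    intro Y hY hq hv
    have u0 : (0 : StateSpace p).u₁ = 0 := rfl
    have v0 : (0 : StateSpace p).v₁ = 0 := rfl
    have θ0 : (0 : StateSpace p).θ = 0 := rfl
    have q0 : (0 : StateSpace p).q = 0 := rfl
    have u20 : (0 : StateSpace p).u₂ = 0 := rfl
    have v20 : (0 : StateSpace p).v₂ = 0 := rfl
    obtain ⟨U, hU, aθ, aw⟩ := hY.exists_solution hq hv 0 (by simp [u0, u20]) (by simp [q0])
      (by simp [u0, θ0]) (by simp [v0, v20])
    have hU0 := eq_zero_of_generator_eq_smul hz hre U (sub_eq_zero.1 hU).symm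
    rw [hU0] at aθ aw
    have e1 : weakDeriv _ (0 : generatorDomain p).1.v₁ = 0 := (weakDeriv p.outer).map_zero
    have e2 : (0 : generatorDomain p).1.θ = 0 := rfl
    rw [e1] at aw
    rw [e2] at aθ
    have z1 := (ae_outer_iff.1 (Lp.coeFn_zero ℂ 2 (volume.restrict (p.outer : Set ℝ)))).1
    have z2 : ∀ᵐ x ∂(volume.restrict (Ioo p.L₁ p.L₂)), (0 : L2 p.inner) x = 0 :=
      Lp.coeFn_zero ℂ 2 (volume.restrict (p.inner : Set ℝ))
    constructor
    · refine eqOn_Icc_of_ae_eq (G := fun _ => 0) p.L₁_pos hY.w₁.continuousOn continuousOn_const ?_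
        ⟨le_rfl, p.L₁_pos.le⟩
      filter_upwards [aw, z1] with x k1 k2
      rw [k2, Pi.zero_apply, eq_comm] at k1
      exact (mul_eq_zero.1 k1).resolve_left (one_div_ne_zero hb)
    · refine eqOn_Icc_of_ae_eq (G := fun _ => 0) p.L₁_lt_L₂ hY.θ.continuousOn continuousOn_const ?_
        ⟨le_rfl, p.L₁_lt_L₂.le⟩
      filter_upwards [aθ, z2] with x k1 k2
      rw [← k1, k2]
  let Φ : ℂ × ℂ →ₗ[ℂ] ℂ × ℂ :=
    { toFun := fun x => (x.1 * Y₁.q p.L₂ + x.2 * Y₂.q p.L₂, x.1 * Y₁.v₂ p.L₃ + x.2 * Y₂.v₂ p.L₃)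
      map_add' := fun x y => by ext <;> simp <;> ring
      map_smul' := fun r x => by ext <;> simp <;> ring }
  have hinj : Function.Injective Φ := by
    rw [← LinearMap.ker_eq_bot, LinearMap.ker_eq_bot']
    rintro ⟨r, s⟩ h
    -- the combination `r Y₁ + s Y₂`
    have hY := (h₁.addSMul h₁ (r - 1)).addSMul h₂ s
    have e1 : r * Y₁.q p.L₂ + s * Y₂.q p.L₂ = 0 := congrArg Prod.fst h
    have e2 : r * Y₁.v₂ p.L₃ + s * Y₂.v₂ p.L₃ = 0 := congrArg Prod.snd h
    obtain ⟨k1, k2⟩ := hom _ hY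
      (by simp only [BarFields.addSMul]; linear_combination e1)
      (by simp only [BarFields.addSMul]; linear_combination e2)
    simp only [BarFields.addSMul, s₁, s₂, t₁, t₂] at k1 k2
    ext
    · change r = 0
      linear_combination k1
    · change s = 0
      linear_combination k2
  obtain ⟨⟨r, s⟩, hrs⟩ := LinearMap.injective_iff_surjective.1 hinj (-Y₀.q p.L₂, -Y₀.v₂ p.L₃)
  have e1 : r * Y₁.q p.L₂ + s * Y₂.q p.L₂ = -Y₀.q p.L₂ := congrArg Prod.fst hrs
  have e2 : r * Y₁.v₂ p.L₃ + s * Y₂.v₂ p.L₃ = -Y₀.v₂ p.L₃ := congrArg Prod.snd hrs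
  obtain ⟨U, hU, -, -⟩ := ((h₀.addSMul h₁ r).addSMul h₂ s).exists_solution
    (by simp only [BarFields.addSMul]; linear_combination e1)
    (by simp only [BarFields.addSMul]; linear_combination e2) F rfl rfl rfl rfl
  exact ⟨U, hU⟩

/-! ### Resolvents -/

section Resolvent

variable {E : Type*} [NormedAddCommGroup E] [NormedSpace ℂ E]

theorem mem_opResolventSet_of_norm_le {T : E →ₗ.[ℂ] E} {z : ℂ}
    (hsurj : ∀ f, ∃ u : T.domain, z • (u : E) - T u = f)
    (hbound : ∀ u : T.domain, ‖(u : E)‖ ≤ ‖z • (u : E) - T u‖) : z ∈ opResolventSet T := by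
  let S : T.domain →ₗ[ℂ] E := z • T.domain.subtype - T.toFun
  have hS : ∀ u, S u = z • (u : E) - T u := fun u => rfl
  have hinj : Function.Injective S := by
    rw [← LinearMap.ker_eq_bot, LinearMap.ker_eq_bot']
    intro u hu
    have := hbound u
    rw [← hS, hu, norm_zero] at this
    exact Subtype.ext (norm_le_zero_iff.1 this)
  let e := LinearEquiv.ofBijective S ⟨hinj, hsurj⟩
  have he : ∀ f, z • (e.symm f : E) - T (e.symm f) = f := fun f => e.apply_symm_apply f
  let R : E →L[ℂ] E := (T.domain.subtype ∘ₗ e.symm.toLinearMap).mkContinuous 1 fun f => by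
    rw [one_mul]
    exact (hbound (e.symm f)).trans_eq (congrArg norm (he f))
  refine ⟨R, fun f => ⟨(e.symm f).2, he f⟩, fun u => ?_⟩
  exact congrArg Subtype.val (e.symm_apply_apply u)

/-- If some `z₀` belongs to the resolvent set and `z - T` is bijective, then `z` belongs to it as
well: `(z - T) R(z₀) = 1 + (z - z₀) R(z₀)` is a bounded bijection, hence boundedly invertible. -/
theorem mem_opResolventSet_of_bijective [CompleteSpace E] {T : E →ₗ.[ℂ] E} {z₀ z : ℂ}
    (h₀ : z₀ ∈ opResolventSet T) (hsurj : ∀ f, ∃ u : T.domain, z • (u : E) - T u = f)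
    (hinj : ∀ u : T.domain, T u = z • (u : E) → u = 0) : z ∈ opResolventSet T := by
  obtain ⟨R, hR, hR'⟩ := h₀
  let S : E →L[ℂ] E := ContinuousLinearMap.id ℂ E + (z - z₀) • R
  have hS : ∀ f, S f = f + (z - z₀) • R f := fun f => rfl
  have hSR : ∀ f, ∃ h : R f ∈ T.domain, S f = z • R f - T ⟨R f, h⟩ := by
    intro f
    obtain ⟨h, hf⟩ := hR f
    refine ⟨h, ?_⟩
    rw [hS, sub_smul]
    nth_rw 1 [← hf]
    abel
  have hker : S.ker = ⊥ := by
    rw [LinearMap.ker_eq_bot']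
    intro f hf
    replace hf : S f = 0 := hf
    obtain ⟨h, e⟩ := hSR f
    rw [hf] at e
    have e0 : (⟨R f, h⟩ : T.domain) = 0 := hinj _ (sub_eq_zero.1 e.symm).symm
    have e1 : R f = 0 := congrArg Subtype.val e0
    rw [hS, e1, smul_zero, add_zero] at hf
    exact hf
  have hrange : S.range = ⊤ := by
    rw [LinearMap.range_eq_top]
    intro g
    obtain ⟨u, hu⟩ := hsurj g
    refine ⟨z₀ • (u : E) - T u, ?_⟩
    change S (z₀ • (u : E) - T u) = g
    rw [hS, hR', ← hu, sub_smul]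
    abel
  let e := ContinuousLinearEquiv.ofBijective S hker hrange
  have he : ∀ f, S (e.symm f) = f := fun f => e.apply_symm_apply f
  have he' : ∀ f, e.symm (S f) = f := fun f => e.symm_apply_apply f
  refine ⟨R ∘L (e.symm : E →L[ℂ] E), fun f => ?_, fun u => ?_⟩
  · obtain ⟨h, k⟩ := hSR (e.symm f)
    exact ⟨h, k.symm.trans (he f)⟩
  · have : z • (u : E) - T u = S (z₀ • (u : E) - T u) := by
      rw [hS, hR', sub_smul]
      abel
    change R (e.symm (z • (u : E) - T u)) = u
    rw [this, he', hR']

theorem zero_notMem_opResolventSet {T : E →ₗ.[ℂ] E} {u : T.domain} (hu : u ≠ 0) (hT : T u = 0) :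
    (0 : ℂ) ∉ opResolventSet T := by
  rintro ⟨R, -, hR⟩
  have := hR u
  rw [hT, zero_smul, sub_zero, map_zero] at this
  exact hu (Subtype.ext this.symm)

theorem isStationarySolution_iff {T : E →ₗ.[ℂ] E} {U₀ : E} :
    IsStationarySolution T U₀ ↔ U₀ ∈ opKernel T := by
  constructor
  · rintro ⟨-, -, V, -, hV⟩
    obtain ⟨h1, h, h2⟩ := hV 0 self_mem_Ici
    have h3 : V 0 = 0 := (uniqueDiffOn_Ici 0 0 self_mem_Ici).eq_deriv _ h1
      (hasDerivWithinAt_const (0 : ℝ) (Ici 0) U₀)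
    exact ⟨⟨U₀, h⟩, (h2.symm.trans h3 : T ⟨U₀, h⟩ = 0), rfl⟩
  · rintro ⟨u, hu, rfl⟩
    have hu' : T u = 0 := hu
    exact ⟨rfl, continuousOn_const, fun _ => 0, continuousOn_const, fun t _ =>
      ⟨hasDerivWithinAt_const _ _ _, u.2, hu'.symm⟩⟩

end Resolvent

theorem one_mem_opResolventSet (p : BarParameters) : (1 : ℂ) ∈ opResolventSet (generator p) := by
  refine mem_opResolventSet_of_norm_le (exists_sub_generator_eq one_ne_zero (by simp)) fun u => ?_
  rw [one_smul]
  exact norm_le_norm_sub_generator u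

theorem mem_opResolventSet_of_re_nonneg {z : ℂ} (hz : z ≠ 0) (hre : 0 ≤ z.re) :
    z ∈ opResolventSet (generator p) :=
  mem_opResolventSet_of_bijective (one_mem_opResolventSet p) (exists_sub_generator_eq hz hre)
    (eq_zero_of_generator_eq_smul hz hre)

end ThermoelasticBar

theorem mainTheorem3 (p : BarParameters) :
    (0 : ℂ) ∈ opSpectrum (generator p) ∧
    (0 : ℂ) ∈ opPointSpectrum (generator p) ∧
    (∃ Z : StateSpace p, IsZeta p Z ∧
      opKernel (generator p) = Submodule.span ℂ {Z} ∧
      ∀ U₀ : StateSpace p,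
        IsStationarySolution (generator p) U₀ ↔ U₀ ∈ Submodule.span ℂ {Z}) ∧
    Module.finrank ℂ (opKernel (generator p)) = 1 ∧
    (∀ l : ℝ, l ≠ 0 → Complex.I * (l : ℂ) ∈ opResolventSet (generator p)) ∧
    Set.range (fun l : ℝ => Complex.I * (l : ℂ)) ∩ opSpectrum (generator p) = {0} := by
  obtain ⟨Z, hZ, h₀, h₁, h₂⟩ := exists_zeta p
  obtain ⟨hdom, hAZ⟩ := zeta_mem_kernel hZ h₀ h₁ h₂
  have hZ0 : Z ≠ 0 := by
    rintro rfl
    have e : weakDeriv _ (0 : StateSpace p).v₁ = 0 := (weakDeriv p.outer).map_zero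
    rw [e] at h₁
    refine slope₂_ne_zero p (const_eq_of_ae p.L₁_pos h₁ ?_)
    exact (ae_outer_iff.1 (Lp.coeFn_zero ℂ 2 (volume.restrict (p.outer : Set ℝ)))).1
  have hu0 : (⟨Z, hdom⟩ : (generator p).domain) ≠ 0 := fun h => hZ0 (congrArg Subtype.val h)
  have hker : opKernel (generator p) = Submodule.span ℂ {Z} := by
    refine le_antisymm ?_ ?_
    · rintro _ ⟨u, hu, rfl⟩
      exact mem_span_of_generator_eq_zero hZ h₀ h₁ h₂ u hu
    · rw [Submodule.span_singleton_le_iff_mem]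
      exact ⟨⟨Z, hdom⟩, hAZ, rfl⟩
  have h0 : (0 : ℂ) ∈ opSpectrum (generator p) := zero_notMem_opResolventSet hu0 hAZ
  have himag : ∀ l : ℝ, l ≠ 0 → Complex.I * (l : ℂ) ∈ opResolventSet (generator p) := fun l hl =>
    mem_opResolventSet_of_re_nonneg
      (mul_ne_zero Complex.I_ne_zero (Complex.ofReal_ne_zero.2 hl)) (by simp)
  refine ⟨h0, ⟨⟨Z, hdom⟩, hu0, by rw [hAZ, zero_smul]⟩,
    ⟨Z, hZ, hker, fun U₀ => by rw [isStationarySolution_iff, hker]⟩, ?_, himag, ?_⟩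
  · rw [hker]
    exact finrank_span_singleton hZ0
  · ext z
    constructor
    · rintro ⟨⟨l, rfl⟩, hl⟩
      by_contra h
      refine hl (himag l ?_)
      rintro rfl
      exact h (by simp)
    · rintro rfl
      exact ⟨⟨0, by simp⟩, h0⟩
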